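/- Let $K$ be a commutative ring, $A$ a unital associative $K$-algebra and $B\subseteq A$ a subalgebra. Write $\mathrm{Aut}_B(A)$ for the group of $K$-algebra automorphisms of $A$ fixing $B$ pointwise, and for $\sigma\in\mathrm{Aut}_B(A)$ let $A_\sigma$ be the $A$-$A$-bimodule $A$ with actions $x\cdot a\cdot y=xa\,\sigma(y)$. Suppose that $A$ is a pseudo-Galois extension of $B$, that is, there are a finite set $\mathcal G\subseteq \mathrm{Aut}_B(A)$ and an integer $N\ge 1$ such that, as $A$-$A$-bimodules, $A\otimes_B A$ is isomorphic to a direct summand of $\bigoplus_{\sigma\in\mathcal G}A_\sigma^N$. Let $G$ be the subgroup of $\mathrm{Aut}_B(A)$ generated by $\mathcal G$ and let $R=C_A(B)$ be the centralizer of $B$ in $A$; $G$ acts on $R$ by restriction. Conventions. A left bialgebroid over $R$ is a $K$-algebra $C$ with an algebra homomorphism $s\colon R\to C$ (source) and an algebra homomorphism $t\colon R^{\rm op}\to C$ (target) with commuting images, made into an $R$-$R$-bimodule by $r\cdot c\cdot r'=s(r)t(r')c$, and with an $R$-coring structure $(\Delta,\varepsilon)$, $\Delta(c)=c_{(1)}\otimes_R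 c_{(2)}\in C\otimes_RC$, such that $\varepsilon(1)=1$, $\Delta(1)=1\otimes_R1$, $c_{(1)}t(r)\otimes_R c_{(2)}=c_{(1)}\otimes_R c_{(2)}s(r)$, $\Delta(cd)=c_{(1)}d_{(1)}\otimes_R c_{(2)}d_{(2)}$ and $\varepsilon(cd)=\varepsilon(c\,s(\varepsilon(d)))=\varepsilon(c\,t(\varepsilon(d)))$. It is a Hopf algebroid if it has an antipode, i.e. an anti-automorphism $\tau$ of the algebra $C$ with $\tau\circ t=s$, $\ \tau^{-1}(c_{(2)})_{(1)}\otimes_R\tau^{-1}(c_{(2)})_{(2)}c_{(1)}=\tau^{-1}(c)\otimes_R1\ $ and $\ \tau(c_{(1)})_{(1)}c_{(2)}\otimes_R\tau(c_{(1)})_{(2)}=1\otimes_R\tau(c)$ for all $c\in C$. A homomorphism of left $R$-bialgebroids is an algebra homomorphism commuting with source, target, counit and comultiplication. Theorem. (1) The $K$-module $R^e\bowtie G:=R\otimes_K R^{\rm op}\otimes_K K[G]$, whose elements are sums of elements $r\otimes\overline{s}\bowtie\sigma$ with $r,s\in R$ and $\sigma\in G$, is a $K$-algebra with product $$(r\otimes\overline{s}\bowtie\sigma)(u\otimes\overline{v}\bowtie\tau)=r\,\sigma(u)\otimes\overline{v\,\tau^{-1}(s)}\bowtie\sigma\tau$$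 and unit $1\otimes\overline1\bowtie e$, and it is a Hopf algebroid over $R$ with source $r\mapsto r\otimes\overline1\bowtie e$, target $r\mapsto 1\otimes\overline r\bowtie e$, counit $r\otimes\overline s\bowtie\sigma\mapsto r\,\sigma(s)$, comultiplication $$r\otimes\overline s\bowtie\sigma\mapsto (r\otimes\overline1\bowtie\sigma)\otimes_R(1\otimes\overline s\bowtie\sigma)$$ and antipode $r\otimes\overline s\bowtie\sigma\mapsto s\otimes\overline r\bowtie\sigma^{-1}$. (2) Let $\mathcal S=\mathrm{End}({}_BA_B)$ be the algebra of $B$-$B$-bimodule endomorphisms of $A$ under composition, and for $r\in R$ let $\lambda_r,\rho_r\in\mathcal S$ be left and right multiplication by $r$. There are left depth two quasibases for $A$ over $B$, i.e. finitely many $t_i\in(A\otimes_BA)^B$ and $\beta_i\in\mathcal S$ with $\sum_it_i\beta_i(x)y=x\otimes_By$ for all $x,y\in A$; and $\mathcal S$ is a left bialgebroid over $R$ with source $\lambda$, target $\rho$, counit $\alpha\mapsto\alpha(1)$ and comultiplication $\Delta(\alpha)=\sum_i\alpha(?\,t_i^1)t_i^2\otimes_R\beta_i$ for every choice of left depth two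 quasibases $(t_i,\beta_i)$, where $t_i=t_i^1\otimes_Bt_i^2$ with summation suppressed. (3) The map $\Psi\colon R^e\bowtie G\to\mathcal S$, $\Psi(r\otimes\overline s\bowtie\sigma)=\lambda_r\circ\sigma\circ\rho_s$, is a surjective homomorphism of left $R$-bialgebroids. -/

import Mathlib

open scoped TensorProduct
open MulOpposite

universe u v

noncomputable section

/-! ### Tensor products over a noncommutative algebra -/

/-- The relations `(m · r) ⊗ n - m ⊗ (r · n)` in `M ⊗[K] N`, where the right action of `R` on `M`
is given by `f : R → End_K M` and the left action of `R` on `N` by `g : R → End_K N`. -/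
def balancedRel (K : Type*) [CommRing K] {R M N : Type*} [AddCommGroup M] [Module K M]
    [AddCommGroup N] [Module K N] (f : R → Module.End K M) (g : R → Module.End K N) :
    Submodule K (M ⊗[K] N) :=
  Submodule.span K {z | ∃ (r : R) (m : M) (n : N), z = f r m ⊗ₜ[K] n - m ⊗ₜ[K] g r n}

/-! ### Left bialgebroids and Hopf algebroids -/

section Bialgebroid

variable {K : Type*} [CommRing K] {R C : Type*} [Ring R] [Algebra K R] [Ring C] [Algebra K C]

/-- The relations `t(r) c ⊗ d - c ⊗ s(r) d` defining `C ⊗_R C`. The `R`-bimodule structure of `C`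
is `r · c · r' = s(r) t(r') c`. -/
def rel₂ (s : R →ₐ[K] C) (t : Rᵐᵒᵖ →ₐ[K] C) : Submodule K (C ⊗[K] C) :=
  balancedRel K (fun r : R => LinearMap.mulLeft K (t (op r))) (fun r : R => LinearMap.mulLeft K (s r))

/-- `C ⊗_R C`. -/
abbrev Tensor₂ (s : R →ₐ[K] C) (t : Rᵐᵒᵖ →ₐ[K] C) : Type _ := (C ⊗[K] C) ⧸ rel₂ s t

/-- The relations defining `C ⊗_R C ⊗_R C` as a quotient of `C ⊗[K] C ⊗[K] C`. -/
def rel₃ (s : R →ₐ[K] C) (t : Rᵐᵒᵖ →ₐ[K] C) : Submodule K ((C ⊗[K] C) ⊗[K] C) :=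
  Submodule.span K
    ({z | ∃ (r : R) (a b c : C),
        z = ((t (op r) * a) ⊗ₜ[K] b) ⊗ₜ[K] c - (a ⊗ₜ[K] (s r * b)) ⊗ₜ[K] c} ∪
     {z | ∃ (r : R) (a b c : C),
        z = (a ⊗ₜ[K] (t (op r) * b)) ⊗ₜ[K] c - (a ⊗ₜ[K] b) ⊗ₜ[K] (s r * c)})

/-- `C ⊗_R C ⊗_R C`. -/
abbrev Tensor₃ (s : R →ₐ[K] C) (t : Rᵐᵒᵖ →ₐ[K] C) : Type _ := ((C ⊗[K] C) ⊗[K] C) ⧸ rel₃ s t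

/-- The class `c ⊗_R d` of a tensor in `C ⊗_R C`, extended linearly. -/
abbrev mk₂ (s : R →ₐ[K] C) (t : Rᵐᵒᵖ →ₐ[K] C) : C ⊗[K] C →ₗ[K] Tensor₂ s t := (rel₂ s t).mkQ

/-- Right multiplication of the `K`-algebra `C ⊗[K] C` on `C ⊗_R C`:
`(c ⊗_R d) · (c' ⊗ d') = c c' ⊗_R d d'`. -/
def act₂ (s : R →ₐ[K] C) (t : Rᵐᵒᵖ →ₐ[K] C) : Tensor₂ s t →ₗ[K] C ⊗[K] C →ₗ[K] Tensor₂ s t :=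
  (rel₂ s t).liftQ ((LinearMap.mul K (C ⊗[K] C)).compr₂ (rel₂ s t).mkQ) <| by
    refine Submodule.span_le.2 ?_
    rintro _ ⟨r, c, d, rfl⟩
    refine LinearMap.mem_ker.2 (TensorProduct.ext' fun c' d' => ?_)
    have h : ((t (op r) * c * c') ⊗ₜ[K] (d * d') - (c * c') ⊗ₜ[K] (s r * d * d') : C ⊗[K] C)
        ∈ rel₂ s t := Submodule.subset_span ⟨r, c * c', d * d', by simp [mul_assoc]⟩
    simpa [sub_mul] using (Submodule.Quotient.mk_eq_zero _).2 h

/-- `(c ⊗_R d, e) ↦ c ⊗_R d ⊗_R e`. -/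
def joinLeft (s : R →ₐ[K] C) (t : Rᵐᵒᵖ →ₐ[K] C) : Tensor₂ s t →ₗ[K] C →ₗ[K] Tensor₃ s t :=
  (rel₂ s t).liftQ ((TensorProduct.mk K (C ⊗[K] C) C).compr₂ (rel₃ s t).mkQ) <| by
    refine Submodule.span_le.2 ?_
    rintro _ ⟨r, a, b, rfl⟩
    refine LinearMap.mem_ker.2 (LinearMap.ext fun c => ?_)
    have h : (((t (op r) * a) ⊗ₜ[K] b) ⊗ₜ[K] c - (a ⊗ₜ[K] (s r * b)) ⊗ₜ[K] c :
        (C ⊗[K] C) ⊗[K] C) ∈ rel₃ s t := Submodule.subset_span (Or.inl ⟨r, a, b, c, rfl⟩)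
    simpa [TensorProduct.sub_tmul] using (Submodule.Quotient.mk_eq_zero _).2 h

/-- `(d ⊗_R e, c) ↦ c ⊗_R d ⊗_R e`. -/
def joinRight (s : R →ₐ[K] C) (t : Rᵐᵒᵖ →ₐ[K] C) : Tensor₂ s t →ₗ[K] C →ₗ[K] Tensor₃ s t :=
  (rel₂ s t).liftQ ((TensorProduct.mk K C (C ⊗[K] C)).flip.compr₂
      ((rel₃ s t).mkQ ∘ₗ (TensorProduct.assoc K C C C).symm.toLinearMap)) <| by
    refine Submodule.span_le.2 ?_
    rintro _ ⟨r, b, c, rfl⟩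
    refine LinearMap.mem_ker.2 (LinearMap.ext fun a => ?_)
    have h : ((a ⊗ₜ[K] (t (op r) * b)) ⊗ₜ[K] c - (a ⊗ₜ[K] b) ⊗ₜ[K] (s r * c) :
        (C ⊗[K] C) ⊗[K] C) ∈ rel₃ s t := Submodule.subset_span (Or.inr ⟨r, a, b, c, rfl⟩)
    simpa [TensorProduct.tmul_sub] using (Submodule.Quotient.mk_eq_zero _).2 h

theorem act₂_mk (s : R →ₐ[K] C) (t : Rᵐᵒᵖ →ₐ[K] C) (w v : C ⊗[K] C) :
    act₂ s t (mk₂ s t w) v = mk₂ s t (w * v) := rfl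

theorem joinLeft_mk (s : R →ₐ[K] C) (t : Rᵐᵒᵖ →ₐ[K] C) (w : C ⊗[K] C) (c : C) :
    joinLeft s t (mk₂ s t w) c = (rel₃ s t).mkQ (w ⊗ₜ[K] c) := rfl

theorem joinRight_mk (s : R →ₐ[K] C) (t : Rᵐᵒᵖ →ₐ[K] C) (w : C ⊗[K] C) (c : C) :
    joinRight s t (mk₂ s t w) c =
      (rel₃ s t).mkQ ((TensorProduct.assoc K C C C).symm (c ⊗ₜ[K] w)) := rfl

/-- A left bialgebroid structure with base algebra `R` on the `K`-algebra `C`.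
In Sweedler notation `Δ(c) = c₁ ⊗_R c₂`; a condition on `c₁, c₂` is imposed for every
representative `w ∈ C ⊗[K] C` of `Δ(c)`. -/
structure LeftBialgebroid (K R C : Type*) [CommRing K] [Ring R] [Algebra K R] [Ring C]
    [Algebra K C] where
  source : R →ₐ[K] C
  target : Rᵐᵒᵖ →ₐ[K] C
  source_target_comm : ∀ r r' : R, source r * target (op r') = target (op r') * source r
  counit : C →ₗ[K] R
  comul : C →ₗ[K] Tensor₂ source target
  /-- `ε` is an `R`-bimodule map. -/
  counit_bimod : ∀ (r r' : R) (c : C), counit (source r * target (op r') * c) = r * counit c * r'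
  /-- `Δ` is an `R`-bimodule map: `Δ(r · c · r') = (r · c₁) ⊗_R (c₂ · r')`. -/
  comul_bimod : ∀ (r r' : R) (c : C) (w : C ⊗[K] C), mk₂ source target w = comul c →
    comul (source r * target (op r') * c) =
      mk₂ source target ((source r ⊗ₜ[K] target (op r')) * w)
  /-- `(Δ ⊗_R id) Δ = (id ⊗_R Δ) Δ`. -/
  coassoc : ∀ (c : C) (w : C ⊗[K] C), mk₂ source target w = comul c →
    TensorProduct.lift (joinLeft source target ∘ₗ comul) w =
      TensorProduct.lift (joinRight source target ∘ₗ comul).flip w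
  /-- `ε(c₁) · c₂ = c`. -/
  counit_left : ∀ (c : C) (w : C ⊗[K] C), mk₂ source target w = comul c →
    TensorProduct.lift ((LinearMap.mul K C) ∘ₗ source.toLinearMap ∘ₗ counit) w = c
  /-- `c₁ · ε(c₂) = c`. -/
  counit_right : ∀ (c : C) (w : C ⊗[K] C), mk₂ source target w = comul c →
    TensorProduct.lift ((LinearMap.mul K C) ∘ₗ target.toLinearMap ∘ₗ
      (opLinearEquiv K).toLinearMap ∘ₗ counit).flip w = c
  counit_one : counit 1 = 1
  comul_one : comul 1 = mk₂ source target (1 ⊗ₜ[K] 1)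
  /-- `c₁ t(r) ⊗_R c₂ = c₁ ⊗_R c₂ s(r)`. -/
  takeuchi : ∀ (c : C) (r : R), act₂ source target (comul c) (target (op r) ⊗ₜ[K] 1) =
    act₂ source target (comul c) (1 ⊗ₜ[K] source r)
  /-- `Δ(c d) = c₁ d₁ ⊗_R c₂ d₂`. -/
  comul_mul : ∀ (c d : C) (w : C ⊗[K] C), mk₂ source target w = comul d →
    comul (c * d) = act₂ source target (comul c) w
  counit_mul_source : ∀ c d : C, counit (c * d) = counit (c * source (counit d))
  counit_mul_target : ∀ c d : C, counit (c * d) = counit (c * target (op (counit d)))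

/-- A Hopf algebroid (Böhm–Szlachányi): a left bialgebroid with an antipode, that is, an
anti-automorphism `τ` of the algebra `C` satisfying the three antipode axioms. -/
structure HopfAlgebroid (K R C : Type*) [CommRing K] [Ring R] [Algebra K R] [Ring C]
    [Algebra K C] extends LeftBialgebroid K R C where
  antipode : C ≃ₐ[K] Cᵐᵒᵖ
  /-- `τ(t(r)) = s(r)`. -/
  antipode_target : ∀ r : R, antipode (target (op r)) = op (source r)
  /-- `τ⁻¹(c₂)₁ ⊗_R τ⁻¹(c₂)₂ c₁ = τ⁻¹(c) ⊗_R 1`. -/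
  antipode_symm_comul : ∀ (c : C) (w : C ⊗[K] C), mk₂ source target w = comul c →
    TensorProduct.lift (((act₂ source target ∘ₗ comul ∘ₗ antipode.symm.toLinearMap ∘ₗ
      (opLinearEquiv K).toLinearMap).compl₂ (TensorProduct.mk K C C 1)).flip) w =
      mk₂ source target (antipode.symm (op c) ⊗ₜ[K] 1)
  /-- `τ(c₁)₁ c₂ ⊗_R τ(c₁)₂ = 1 ⊗_R τ(c)`. -/
  antipode_comul : ∀ (c : C) (w : C ⊗[K] C), mk₂ source target w = comul c →
    TensorProduct.lift ((act₂ source target ∘ₗ comul ∘ₗ (opLinearEquiv K).symm.toLinearMap ∘ₗ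
      antipode.toLinearMap).compl₂ ((TensorProduct.mk K C C).flip 1)) w =
      mk₂ source target (1 ⊗ₜ[K] unop (antipode c))

/-- `Ψ` is a homomorphism of left `R`-bialgebroids: an algebra homomorphism that commutes with the
source, target, counit and comultiplication maps. -/
structure LeftBialgebroid.IsHom {D : Type*} [Ring D] [Algebra K D] (H : LeftBialgebroid K R C)
    (S : LeftBialgebroid K R D) (Ψ : C →ₐ[K] D) : Prop where
  map_source : ∀ r : R, Ψ (H.source r) = S.source r
  map_target : ∀ r : R, Ψ (H.target (op r)) = S.target (op r)
  map_counit : ∀ c : C, S.counit (Ψ c) = H.counit c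
  /-- `Δ(Ψ(c)) = Ψ(c₁) ⊗_R Ψ(c₂)`. -/
  map_comul : ∀ (c : C) (w : C ⊗[K] C), mk₂ H.source H.target w = H.comul c →
    S.comul (Ψ c) = mk₂ S.source S.target (TensorProduct.map Ψ.toLinearMap Ψ.toLinearMap w)

end Bialgebroid

/-! ### The algebra `R^e ⋈ G` -/

section Bowtie

variable (K : Type*) [CommRing K] (R : Type*) [Ring R] [Algebra K R] (G : Type*)

/-- The underlying `K`-module `R ⊗ R^op ⊗ K[G]` of `R^e ⋈ G`. -/
def Bowtie : Type _ := (R ⊗[K] Rᵐᵒᵖ) ⊗[K] MonoidAlgebra K G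

instance : AddCommGroup (Bowtie K R G) :=
  inferInstanceAs (AddCommGroup ((R ⊗[K] Rᵐᵒᵖ) ⊗[K] MonoidAlgebra K G))

instance : Module K (Bowtie K R G) :=
  inferInstanceAs (Module K ((R ⊗[K] Rᵐᵒᵖ) ⊗[K] MonoidAlgebra K G))

namespace Bowtie

variable {G}

/-- `x ↦ x ⋈ σ` for `x ∈ R^e = R ⊗ R^op`. -/
def incl (σ : G) : R ⊗[K] Rᵐᵒᵖ →ₗ[K] Bowtie K R G :=
  (TensorProduct.mk K (R ⊗[K] Rᵐᵒᵖ) (MonoidAlgebra K G)).flip (MonoidAlgebra.single σ 1)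

variable {R}

/-- The element `r ⊗ s̄ ⋈ σ`. -/
def pure (r s : R) (σ : G) : Bowtie K R G := incl K R σ (r ⊗ₜ[K] op s)

variable {K} in
theorem hom_ext {M : Type*} [AddCommGroup M] [Module K M] {f g : Bowtie K R G →ₗ[K] M}
    (h : ∀ σ x, f (incl K R σ x) = g (incl K R σ x)) : f = g := by
  refine TensorProduct.ext (LinearMap.ext fun x => MonoidAlgebra.lhom_ext' fun σ =>
    LinearMap.ext_ring ?_)
  exact h σ x

/-- The linear map out of `R^e ⋈ G` with given restrictions to the summands `R^e ⋈ σ`. -/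
def desc {M : Type*} [AddCommGroup M] [Module K M] (f : G → (R ⊗[K] Rᵐᵒᵖ →ₗ[K] M)) :
    Bowtie K R G →ₗ[K] M :=
  TensorProduct.lift
    (Finsupp.linearCombination K f ∘ₗ (MonoidAlgebra.coeffLinearEquiv K).toLinearMap).flip

theorem desc_incl {M : Type*} [AddCommGroup M] [Module K M]
    (f : G → (R ⊗[K] Rᵐᵒᵖ →ₗ[K] M)) (σ : G) (x : R ⊗[K] Rᵐᵒᵖ) :
    desc K f (incl K R σ x) = f σ x := by
  unfold desc incl
  erw [TensorProduct.lift.tmul]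
  simp [MonoidAlgebra.coeffLinearEquiv]

variable [Group G] [MulSemiringAction G R] [SMulCommClass G K R]

/-- `r ⊗ s̄ ↦ σ(r) ⊗ s̄`. -/
def actL (σ : G) : R ⊗[K] Rᵐᵒᵖ →ₐ[K] R ⊗[K] Rᵐᵒᵖ :=
  Algebra.TensorProduct.map (MulSemiringAction.toAlgHom K R σ) (AlgHom.id K Rᵐᵒᵖ)

/-- `r ⊗ s̄ ↦ r ⊗ σ(s)‾`. -/
def actR (σ : G) : R ⊗[K] Rᵐᵒᵖ →ₐ[K] R ⊗[K] Rᵐᵒᵖ :=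
  Algebra.TensorProduct.map (AlgHom.id K R) (AlgHom.op (MulSemiringAction.toAlgHom K R σ))

/-- The multiplication: `(r ⊗ s̄ ⋈ σ) (u ⊗ v̄ ⋈ τ) = r σ(u) ⊗ (v τ⁻¹(s))‾ ⋈ σ τ`. -/
def mulMap : Bowtie K R G →ₗ[K] Bowtie K R G →ₗ[K] Bowtie K R G :=
  desc K fun σ => LinearMap.flip <| desc K fun τ => LinearMap.flip <|
    ((LinearMap.mul K (R ⊗[K] Rᵐᵒᵖ)).compl₁₂ (actR K τ⁻¹).toLinearMap
      (actL K σ).toLinearMap).compr₂ (incl K R (σ * τ))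

theorem mulMap_incl (σ τ : G) (x y : R ⊗[K] Rᵐᵒᵖ) :
    mulMap K (incl K R σ x) (incl K R τ y) = incl K R (σ * τ) (actR K τ⁻¹ x * actL K σ y) := by
  simp [mulMap, desc_incl]

theorem actL_actL (σ τ : G) (x : R ⊗[K] Rᵐᵒᵖ) : actL K σ (actL K τ x) = actL K (σ * τ) x := by
  have : (actL (R := R) K σ).comp (actL K τ) = actL K (σ * τ) := by
    ext <;> simp [actL, mul_smul]
  exact congr($this x)

theorem actR_actR (σ τ : G) (x : R ⊗[K] Rᵐᵒᵖ) : actR K σ (actR K τ x) = actR K (σ * τ) x := by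
  have : (actR (R := R) K σ).comp (actR K τ) = actR K (σ * τ) := by
    ext <;> simp [actR, mul_smul]
  exact congr($this x)

theorem actL_actR (σ τ : G) (x : R ⊗[K] Rᵐᵒᵖ) :
    actL K σ (actR K τ x) = actR K τ (actL K σ x) := by
  have : (actL (R := R) K σ).comp (actR (R := R) K τ) = (actR (R := R) K τ).comp (actL (R := R) K σ) := by
    ext <;> simp [actR, actL]
  exact congr($this x)

theorem actL_one (x : R ⊗[K] Rᵐᵒᵖ) : actL K (1 : G) x = x := by
  have : actL K (1 : G) = AlgHom.id K (R ⊗[K] Rᵐᵒᵖ) := by ext <;> simp [actL]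
  exact congr($this x)

theorem actR_one (x : R ⊗[K] Rᵐᵒᵖ) : actR K (1 : G) x = x := by
  have : actR K (1 : G) = AlgHom.id K (R ⊗[K] Rᵐᵒᵖ) := by ext <;> simp [actR]
  exact congr($this x)

theorem mulMap_assoc (a b c : Bowtie K R G) :
    mulMap K (mulMap K a b) c = mulMap K a (mulMap K b c) := by
  have : (mulMap (R := R) (G := G) K).compr₂ (mulMap K) =
      ((LinearMap.llcomp K (Bowtie K R G) (Bowtie K R G) (Bowtie K R G)).flip.comp
        (mulMap (R := R) (G := G) K)).flip.comp (mulMap K) := by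
    refine hom_ext fun σ x => hom_ext fun τ y => hom_ext fun κ z => ?_
    simp [mulMap_incl, actR_actR, actL_actL, actL_actR, mul_assoc]
  exact congr($this a b c)

instance : One (Bowtie K R G) := ⟨pure K 1 1 1⟩

instance : Ring (Bowtie K R G) where
  __ := (inferInstance : AddCommGroup (Bowtie K R G))
  mul a b := mulMap K a b
  left_distrib a b c := map_add (mulMap K a) b c
  right_distrib a b c := by
    change mulMap K (a + b) c = mulMap K a c + mulMap K b c
    simp
  zero_mul a := by
    change mulMap K 0 a = 0
    simp
  mul_zero a := map_zero (mulMap K a)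
  mul_assoc a b c := mulMap_assoc K a b c
  one_mul a := by
    have : mulMap K (incl K R 1 (1 ⊗ₜ[K] 1) : Bowtie K R G) = LinearMap.id :=
      hom_ext fun σ x => by
        simp [mulMap_incl, ← Algebra.TensorProduct.one_def, actL_one]
    exact congr($this a)
  mul_one a := by
    have : (mulMap K).flip (incl K R 1 (1 ⊗ₜ[K] 1) : Bowtie K R G) = LinearMap.id :=
      hom_ext fun σ x => by
        simp [mulMap_incl, ← Algebra.TensorProduct.one_def, actR_one]
    exact congr($this a)

instance : Algebra K (Bowtie K R G) :=
  Algebra.ofModule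
    (fun k a b => by
      change mulMap K (k • a) b = k • mulMap K a b
      simp)
    (fun k a b => LinearMap.map_smul (mulMap K a) k b)

end Bowtie

end Bowtie

/-! ### Algebra extensions -/

section Extension

variable {K : Type v} [CommRing K] {A : Type u} [Ring A] [Algebra K A] (B : Subalgebra K A)

/-- The group `Aut_B(A)` of `K`-algebra automorphisms of `A` that fix `B` pointwise. -/
abbrev BAut : Type u := fixingSubgroup (A ≃ₐ[K] A) (B : Set A)

/-- The centralizer `R = C_A(B)`. -/
abbrev centr : Subalgebra K A := Subalgebra.centralizer K (B : Set A)

theorem BAut.apply_mem (σ : BAut B) {b : A} (hb : b ∈ B) : (σ : A ≃ₐ[K] A) b = b :=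
  (mem_fixingSubgroup_iff _).1 σ.2 b hb

/-- The elements of `Aut_B(A)` restrict to automorphisms of the centralizer. -/
instance : MulSemiringAction (BAut B) (centr B) where
  smul σ r := ⟨(σ : A ≃ₐ[K] A) r, by
    rw [Subalgebra.mem_centralizer_iff]
    intro b hb
    have h := congr((σ : A ≃ₐ[K] A) $((Subalgebra.mem_centralizer_iff K).1 r.2 b hb))
    simpa [BAut.apply_mem B σ hb] using h⟩
  one_smul _ := rfl
  mul_smul _ _ _ := rfl
  smul_zero σ := Subtype.ext (map_zero (σ : A ≃ₐ[K] A))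
  smul_add σ _ _ := Subtype.ext (map_add (σ : A ≃ₐ[K] A) _ _)
  smul_one σ := Subtype.ext (map_one (σ : A ≃ₐ[K] A))
  smul_mul σ _ _ := Subtype.ext (map_mul (σ : A ≃ₐ[K] A) _ _)

instance : SMulCommClass (BAut B) K (centr B) where
  smul_comm σ k r := Subtype.ext (map_smul (σ : A ≃ₐ[K] A) k (r : A))

/-- The tensor square `A ⊗_B A`. -/
def TensorSquare : Type u :=
  (A ⊗[K] A) ⧸ balancedRel K (fun b : B => LinearMap.mulRight K (b : A))
    (fun b : B => LinearMap.mulLeft K (b : A))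

namespace TensorSquare

instance : AddCommGroup (TensorSquare B) := inferInstanceAs (AddCommGroup (_ ⧸ balancedRel K _ _))

instance : Module K (TensorSquare B) := inferInstanceAs (Module K (_ ⧸ balancedRel K _ _))

/-- The quotient map `A ⊗[K] A → A ⊗_B A`. -/
def mkQ : A ⊗[K] A →ₗ[K] TensorSquare B := Submodule.mkQ _

/-- The element `x ⊗_B y`. -/
def tmul (x y : A) : TensorSquare B := mkQ B (x ⊗ₜ[K] y)

/-- The linear map out of `A ⊗_B A` induced by a `B`-balanced bilinear map. -/
def lift {M : Type*} [AddCommGroup M] [Module K M] (f : A →ₗ[K] A →ₗ[K] M)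
    (hf : ∀ (x : A) (b : B) (y : A), f (x * b) y = f x (b * y)) : TensorSquare B →ₗ[K] M :=
  Submodule.liftQ _ (TensorProduct.lift f) <| by
    refine Submodule.span_le.2 ?_
    rintro _ ⟨b, x, y, rfl⟩
    simp [LinearMap.mem_ker, hf]

theorem lift_tmul {M : Type*} [AddCommGroup M] [Module K M] (f : A →ₗ[K] A →ₗ[K] M)
    (hf : ∀ (x : A) (b : B) (y : A), f (x * b) y = f x (b * y)) (x y : A) :
    lift B f hf (tmul B x y) = f x y :=
  (Submodule.liftQ_apply _ _ _).trans (TensorProduct.lift.tmul x y)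

variable {B} in
theorem hom_ext {M : Type*} [AddCommGroup M] [Module K M] {f g : TensorSquare B →ₗ[K] M}
    (h : ∀ x y, f (tmul B x y) = g (tmul B x y)) : f = g :=
  Submodule.linearMap_qext _ (TensorProduct.ext' h)

theorem tmul_balanced (x : A) (b : B) (y : A) : tmul B (x * b) y = tmul B x (b * y) :=
  (Submodule.Quotient.eq _).2 (Submodule.subset_span ⟨b, x, y, rfl⟩)

/-- `(x, y) ↦ x ⊗_B y` as a bilinear map. -/
def tmulBilin : A →ₗ[K] A →ₗ[K] TensorSquare B := (TensorProduct.mk K A A).compr₂ (mkQ B)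

theorem lmul_aux (a x : A) (b : B) (y : A) :
    (tmulBilin B).comp (LinearMap.mulLeft K a) (x * b) y =
      (tmulBilin B).comp (LinearMap.mulLeft K a) x (b * y) := by
  change tmul B (a * (x * b)) y = tmul B (a * x) (b * y)
  rw [← mul_assoc, tmul_balanced]

theorem rmul_aux (a x : A) (b : B) (y : A) :
    (tmulBilin B).compl₂ (LinearMap.mulRight K a) (x * b) y =
      (tmulBilin B).compl₂ (LinearMap.mulRight K a) x (b * y) := by
  change tmul B (x * b) (y * a) = tmul B x (b * y * a)
  rw [mul_assoc, tmul_balanced]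

/-- Left multiplication `a · (x ⊗ y) = a x ⊗ y`. -/
def lmul : A →+* Module.End K (TensorSquare B) where
  toFun a := lift B ((tmulBilin B).comp (LinearMap.mulLeft K a)) (lmul_aux B a)
  map_one' := hom_ext fun x y => by
    rw [lift_tmul]
    change tmul B (1 * x) y = tmul B x y
    rw [one_mul]
  map_mul' a a' := hom_ext fun x y => by
    rw [lift_tmul, Module.End.mul_apply, lift_tmul]
    change tmul B (a * a' * x) y = lift B _ _ (tmul B (a' * x) y)
    rw [lift_tmul]
    change tmul B (a * a' * x) y = tmul B (a * (a' * x)) y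
    rw [mul_assoc]
  map_zero' := hom_ext fun x y => by
    rw [lift_tmul]
    simp
  map_add' a a' := hom_ext fun x y => by
    rw [LinearMap.add_apply, lift_tmul, lift_tmul, lift_tmul]
    simp [add_mul]

/-- Right multiplication `(x ⊗ y) · a = x ⊗ y a`. -/
def rmul : Aᵐᵒᵖ →+* Module.End K (TensorSquare B) where
  toFun a := lift B ((tmulBilin B).compl₂ (LinearMap.mulRight K a.unop)) (rmul_aux B a.unop)
  map_one' := hom_ext fun x y => by
    rw [lift_tmul]
    change tmul B x (y * 1) = tmul B x y
    rw [mul_one]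
  map_mul' a a' := hom_ext fun x y => by
    rw [lift_tmul, Module.End.mul_apply, lift_tmul]
    change tmul B x (y * (a'.unop * a.unop)) = lift B _ _ (tmul B x (y * a'.unop))
    rw [lift_tmul]
    change _ = tmul B x (y * a'.unop * a.unop)
    rw [mul_assoc]
  map_zero' := hom_ext fun x y => by
    rw [lift_tmul]
    simp
  map_add' a a' := hom_ext fun x y => by
    rw [LinearMap.add_apply, lift_tmul, lift_tmul, lift_tmul]
    simp [mul_add]

/-- The natural `A`-`A`-bimodule structure of `A ⊗_B A`. -/
instance : Module A (TensorSquare B) := Module.compHom _ (lmul B)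

instance : Module Aᵐᵒᵖ (TensorSquare B) := Module.compHom _ (rmul B)

theorem smul_tmul (a x y : A) : a • tmul B x y = tmul B (a * x) y :=
  lift_tmul B ((tmulBilin B).comp (LinearMap.mulLeft K a)) (lmul_aux B a) x y

theorem op_smul_tmul (a x y : A) : op a • tmul B x y = tmul B x (y * a) :=
  lift_tmul B ((tmulBilin B).compl₂ (LinearMap.mulRight K a)) (rmul_aux B a) x y

end TensorSquare

/-- The bimodule `A_σ`, twisted on the right by the automorphism `σ`: `x · a · y = x a σ(y)`. -/
def Twisted (_σ : A ≃ₐ[K] A) : Type u := A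

namespace Twisted

variable (σ : A ≃ₐ[K] A)

instance : AddCommGroup (Twisted σ) := inferInstanceAs (AddCommGroup A)

instance : Module A (Twisted σ) := inferInstanceAs (Module A A)

instance : Module Aᵐᵒᵖ (Twisted σ) :=
  Module.compHom A (RingEquiv.op σ.toRingEquiv).toRingHom

theorem smul_eq (x a : A) : x • (show Twisted σ from a) = x * a := rfl

theorem op_smul_eq (y a : A) : op y • (show Twisted σ from a) = a * σ y := rfl

end Twisted

/-- `A ‖ B` is pseudo-Galois with respect to the finite set `𝒢 ⊆ Aut_B(A)`: for some positive `N`,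
`A ⊗_B A ⊕ M ≅ ⨁_{σ ∈ 𝒢} A_σ^N` as `A`-`A`-bimodules for some bimodule `M`. -/
def IsPseudoGalois (𝒢 : Finset (BAut B)) : Prop :=
  ∃ (N : ℕ) (_ : 0 < N) (M : Type u) (_ : AddCommGroup M) (_ : Module A M) (_ : Module Aᵐᵒᵖ M)
    (_ : SMulCommClass A Aᵐᵒᵖ M)
    (e : (TensorSquare B × M) ≃ₗ[A] ((σ : 𝒢) → Fin N → Twisted (σ.1 : A ≃ₐ[K] A))),
    ∀ (a : A) (z : TensorSquare B × M), e (op a • z) = op a • e z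

/-- The algebra `𝒮 = End(_B A_B)` of `B`-`B`-bimodule endomorphisms of `A` under composition. -/
def biEnd : Subalgebra K (Module.End K A) where
  carrier := {α | ∀ b ∈ B, ∀ a : A, α (b * a) = b * α a ∧ α (a * b) = α a * b}
  mul_mem' hα hβ b hb a := by
    simp [(hβ b hb a).1, (hβ b hb a).2, (hα b hb _).1, (hα b hb _).2]
  add_mem' hα hβ b hb a := by
    simp [(hβ b hb a).1, (hβ b hb a).2, (hα b hb a).1, (hα b hb a).2, mul_add, add_mul]
  algebraMap_mem' k b _ a := by
    simp [Module.algebraMap_end_apply]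

/-- For `α ∈ 𝒮` and `t = t¹ ⊗ t² ∈ A ⊗_B A`, the element `α(x t¹) t²` of `A`. -/
def biEnd.insertAt (α : biEnd B) (x : A) : TensorSquare B →ₗ[K] A :=
  TensorSquare.lift B ((LinearMap.mul K A).comp ((α : Module.End K A) ∘ₗ LinearMap.mulLeft K x))
    fun u b y => by
      simp [← mul_assoc, (α.2 b b.2 _).2]

/-- For `α ∈ 𝒮` and `t = t¹ ⊗ t² ∈ (A ⊗_B A)^B`, the endomorphism `x ↦ α(x t¹) t²` in `𝒮`. -/
def biEnd.insert (α : biEnd B) (t : TensorSquare B) (ht : ∀ b ∈ B, b • t = op b • t) :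
    biEnd B :=
  ⟨{ toFun := fun x => biEnd.insertAt B α x t
     map_add' := fun x y => by
      have : biEnd.insertAt B α (x + y) = biEnd.insertAt B α x + biEnd.insertAt B α y :=
        TensorSquare.hom_ext fun u v => by
          simp [biEnd.insertAt, TensorSquare.lift_tmul, add_mul]
      simp [this]
     map_smul' := fun k x => by
      have : biEnd.insertAt B α (k • x) = k • biEnd.insertAt B α x :=
        TensorSquare.hom_ext fun u v => by
          simp [biEnd.insertAt, TensorSquare.lift_tmul]
      simp [this] }, by
    intro b hb a
    constructor
    · have : biEnd.insertAt B α (b * a) = LinearMap.mulLeft K b ∘ₗ biEnd.insertAt B α a :=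
        TensorSquare.hom_ext fun u v => by
          simp [biEnd.insertAt, TensorSquare.lift_tmul, mul_assoc, (α.2 b hb _).1]
      exact congr($this t)
    · have h₁ : biEnd.insertAt B α (a * b) = biEnd.insertAt B α a ∘ₗ TensorSquare.lmul B b :=
        TensorSquare.hom_ext fun u v => by
          have : (TensorSquare.lmul B b) (TensorSquare.tmul B u v) = TensorSquare.tmul B (b * u) v :=
            TensorSquare.smul_tmul B b u v
          simp [this, biEnd.insertAt, TensorSquare.lift_tmul, ← mul_assoc]
      have h₂ : biEnd.insertAt B α a ∘ₗ TensorSquare.rmul B (op b) =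
          LinearMap.mulRight K b ∘ₗ biEnd.insertAt B α a :=
        TensorSquare.hom_ext fun u v => by
          have : (TensorSquare.rmul B (op b)) (TensorSquare.tmul B u v) =
            TensorSquare.tmul B u (v * b) := TensorSquare.op_smul_tmul B b u v
          simp [this, biEnd.insertAt, TensorSquare.lift_tmul, mul_assoc]
      have h₃ : TensorSquare.lmul B b t = TensorSquare.rmul B (op b) t := ht b hb
      calc biEnd.insertAt B α (a * b) t = biEnd.insertAt B α a (TensorSquare.lmul B b t) :=
            congr($h₁ t)
        _ = biEnd.insertAt B α a (TensorSquare.rmul B (op b) t) := by rw [h₃]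
        _ = biEnd.insertAt B α a t * b := congr($h₂ t)⟩

/-- Left depth two quasibases: `t_i ∈ (A ⊗_B A)^B` and `β_i ∈ 𝒮`, `i < n`, with
`∑ t_i β_i(x) y = x ⊗_B y`. -/
structure LeftQuasibases where
  n : ℕ
  t : Fin n → TensorSquare B
  t_central : ∀ i, ∀ b ∈ B, b • t i = op b • t i
  β : Fin n → biEnd B
  sum_eq : ∀ x y : A,
    ∑ i, op ((β i : Module.End K A) x * y) • t i = TensorSquare.tmul B x y

/-- `S` is the left bialgebroid of the (left) depth two extension `A ‖ B`: the source and target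
maps are left and right multiplication, the counit is evaluation at `1`, and the comultiplication
is `Δ(α) = ∑ α(? t_i¹) t_i² ⊗_R β_i` for any left depth two quasibases. -/
structure IsEndBialgebroid (S : LeftBialgebroid K (centr B) (biEnd B)) : Prop where
  source_eq : ∀ r : centr B, (S.source r : Module.End K A) = LinearMap.mulLeft K (r : A)
  target_eq : ∀ r : centr B, (S.target (op r) : Module.End K A) = LinearMap.mulRight K (r : A)
  counit_eq : ∀ α : biEnd B, (S.counit α : A) = (α : Module.End K A) 1
  exists_quasibases : Nonempty (LeftQuasibases B)
  comul_eq : ∀ (Q : LeftQuasibases B) (α : biEnd B),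
    S.comul α = mk₂ S.source S.target
      (∑ i, biEnd.insert B α (Q.t i) (Q.t_central i) ⊗ₜ[K] Q.β i)

end Extension

end

/-!
Write `R = C_A(B)`, `𝒮 = End(_B A_B)`, and let `G` be the group generated by `𝒢`.

The Hopf algebroid axioms of `R^e ⋈ G` are computations on the elements `r ⊗ s̄ ⋈ σ`. They hold for
every group `G` acting on an algebra `R`. An axiom in Sweedler notation is imposed on all
representatives in `C ⊗[K] C` of `Δ(c)`; since each of them is balanced over `R`, it suffices to
check it on the representative `(r ⊗ 1 ⋈ σ) ⊗ (1 ⊗ s̄ ⋈ σ)` of `Δ(r ⊗ s̄ ⋈ σ)`, see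
`Bowtie.apply_eq_of_mk₂_eq_comul`.

For `𝒮` the key point is that, given left depth two quasibases `(t_i, β_i)`, an element of `𝒮 ⊗_R 𝒮`
is determined by the map `x ⊗ y ↦ α(x) β(y)` it induces on `A ⊗ A`, and similarly for three factors
(`QuasibasisRep.tensor₂_ext`, `QuasibasisRep.tensor₃_ext`). Indeed `β = ∑ λ_{r_i} β_i` with
`r_i = β(t_i¹) t_i² ∈ R`, so that `α ⊗_R β = ∑ α(?) β(t_i¹) t_i² ⊗_R β_i` is recovered from the induced
map. Under this embedding `Δ(α)` is the map `x ⊗ y ↦ α(x y)`. This shows that `Δ` does not depend on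
the quasibases, and turns the bialgebroid axioms, as well as the compatibility of `Ψ` with `Δ`, into
identities in `A`; the latter is the multiplicativity of the automorphisms `σ`.

Finally, if `A ‖ B` is pseudo-Galois, then the split monomorphism `A ⊗_B A → ⨁ A_σ^N` and its
retraction give elements `c_j ∈ R`, `t_j ∈ (A ⊗_B A)^B` and `σ_j ∈ 𝒢` with
`x ⊗_B y = ∑ x c_j σ_j(y) t_j` and `t_j y = σ_j(y) t_j`. Hence `(t_j, σ_j⁻¹ ∘ ρ_{c_j})` are left depth
two quasibases (`IsPseudoGalois.exists_quasibases`). As the `β_j` lie in the image of `Ψ` and generate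
`𝒮` as a left `R`-module, `Ψ` is surjective.
-/

noncomputable section

/-! ### Maps out of balanced tensor products -/

section Bialgebroid

variable {K : Type*} [CommRing K] {R C M : Type*} [Ring R] [Algebra K R] [Ring C] [Algebra K C]
  [AddCommGroup M] [Module K M]

theorem rel₂_le_ker (s : R →ₐ[K] C) (t : Rᵐᵒᵖ →ₐ[K] C) {f : C ⊗[K] C →ₗ[K] M}
    (hf : ∀ (r : R) (c d : C), f ((t (op r) * c) ⊗ₜ[K] d) = f (c ⊗ₜ[K] (s r * d))) :
    rel₂ s t ≤ LinearMap.ker f := by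
  refine Submodule.span_le.2 ?_
  rintro _ ⟨r, c, d, rfl⟩
  simpa [LinearMap.mem_ker, sub_eq_zero] using hf r c d

/-- A balanced map evaluated at a representative of `Δ(c)` is the value at `Δ(c)` of the induced
map on `C ⊗_R C`. -/
theorem apply_eq_liftQ_of_mk₂_eq (s : R →ₐ[K] C) (t : Rᵐᵒᵖ →ₐ[K] C) {f : C ⊗[K] C →ₗ[K] M}
    (hf : ∀ (r : R) (c d : C), f ((t (op r) * c) ⊗ₜ[K] d) = f (c ⊗ₜ[K] (s r * d)))
    {w : C ⊗[K] C} {z : Tensor₂ s t} (h : mk₂ s t w = z) :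
    f w = (rel₂ s t).liftQ f (rel₂_le_ker s t hf) z := by
  rw [← h]
  rfl

theorem mk₂_balanced (s : R →ₐ[K] C) (t : Rᵐᵒᵖ →ₐ[K] C) (r : R) (c d : C) :
    mk₂ s t ((t (op r) * c) ⊗ₜ[K] d) = mk₂ s t (c ⊗ₜ[K] (s r * d)) :=
  (Submodule.Quotient.eq _).2 (Submodule.subset_span ⟨r, c, d, rfl⟩)

theorem mk₃_balanced_left (s : R →ₐ[K] C) (t : Rᵐᵒᵖ →ₐ[K] C) (r : R) (a b c : C) :
    (rel₃ s t).mkQ (((t (op r) * a) ⊗ₜ[K] b) ⊗ₜ[K] c) =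
      (rel₃ s t).mkQ ((a ⊗ₜ[K] (s r * b)) ⊗ₜ[K] c) :=
  (Submodule.Quotient.eq _).2 (Submodule.subset_span (Or.inl ⟨r, a, b, c, rfl⟩))

theorem mk₃_balanced_right (s : R →ₐ[K] C) (t : Rᵐᵒᵖ →ₐ[K] C) (r : R) (a b c : C) :
    (rel₃ s t).mkQ ((a ⊗ₜ[K] (t (op r) * b)) ⊗ₜ[K] c) =
      (rel₃ s t).mkQ ((a ⊗ₜ[K] b) ⊗ₜ[K] (s r * c)) :=
  (Submodule.Quotient.eq _).2 (Submodule.subset_span (Or.inr ⟨r, a, b, c, rfl⟩))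

theorem act₂_act₂ (s : R →ₐ[K] C) (t : Rᵐᵒᵖ →ₐ[K] C) (z : Tensor₂ s t) (v v' : C ⊗[K] C) :
    act₂ s t (act₂ s t z v) v' = act₂ s t z (v * v') := by
  obtain ⟨w, rfl⟩ := (rel₂ s t).mkQ_surjective z
  rw [act₂_mk, act₂_mk, act₂_mk, mul_assoc]

/-- If `z` lies in the Takeuchi product, then `z · (c ⊗ d)` depends only on `c ⊗_R d`. -/
theorem act₂_balanced (s : R →ₐ[K] C) (t : Rᵐᵒᵖ →ₐ[K] C) {z : Tensor₂ s t} {r : R}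
    (hz : act₂ s t z (t (op r) ⊗ₜ[K] 1) = act₂ s t z (1 ⊗ₜ[K] s r)) (c d : C) :
    act₂ s t z ((t (op r) * c) ⊗ₜ[K] d) = act₂ s t z (c ⊗ₜ[K] (s r * d)) := by
  have h := congr(act₂ s t $hz (c ⊗ₜ[K] d))
  rw [act₂_act₂, act₂_act₂] at h
  simpa using h

theorem joinLeft_target_mul (s : R →ₐ[K] C) (t : Rᵐᵒᵖ →ₐ[K] C) (r : R) (v : C ⊗[K] C) (c : C) :
    joinLeft s t (mk₂ s t ((1 ⊗ₜ[K] t (op r)) * v)) c = joinLeft s t (mk₂ s t v) (s r * c) := by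
  have : (joinLeft s t).flip c ∘ₗ mk₂ s t ∘ₗ LinearMap.mulLeft K (1 ⊗ₜ[K] t (op r)) =
      (joinLeft s t).flip (s r * c) ∘ₗ mk₂ s t := TensorProduct.ext' fun a b => by
    simpa [joinLeft_mk, -Submodule.mkQ_apply] using mk₃_balanced_right s t r a b c
  exact congr($this v)

theorem joinRight_source_mul (s : R →ₐ[K] C) (t : Rᵐᵒᵖ →ₐ[K] C) (r : R) (v : C ⊗[K] C) (c : C) :
    joinRight s t (mk₂ s t ((s r ⊗ₜ[K] 1) * v)) c =
      joinRight s t (mk₂ s t v) (t (op r) * c) := by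
  have : (joinRight s t).flip c ∘ₗ mk₂ s t ∘ₗ LinearMap.mulLeft K (s r ⊗ₜ[K] 1) =
      (joinRight s t).flip (t (op r) * c) ∘ₗ mk₂ s t := TensorProduct.ext' fun a b => by
    simpa [joinRight_mk, -Submodule.mkQ_apply] using (mk₃_balanced_left s t r c a b).symm
  exact congr($this v)

end Bialgebroid

/-! ### The Hopf algebroid `R^e ⋈ G` -/

namespace Bowtie

variable (K : Type*) [CommRing K] {R : Type*} [Ring R] [Algebra K R] {G : Type*}

variable {K} in
theorem hom_ext_pure {M : Type*} [AddCommGroup M] [Module K M] {f g : Bowtie K R G →ₗ[K] M}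
    (h : ∀ r s σ, f (pure K r s σ) = g (pure K r s σ)) : f = g := by
  refine hom_ext fun σ x => ?_
  have : f ∘ₗ incl K R σ = g ∘ₗ incl K R σ :=
    TensorProduct.ext' fun r s => h r (unop s) σ
  exact congr($this x)

/-- The linear map out of `R^e ⋈ G` given by bilinear maps in `r, s` for each `σ`. -/
def descPure {M : Type*} [AddCommGroup M] [Module K M] (f : G → (R →ₗ[K] R →ₗ[K] M)) :
    Bowtie K R G →ₗ[K] M :=
  desc K fun σ => TensorProduct.lift ((f σ).compl₂ (opLinearEquiv K).symm.toLinearMap)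

theorem descPure_pure {M : Type*} [AddCommGroup M] [Module K M] (f : G → (R →ₗ[K] R →ₗ[K] M))
    (r s : R) (σ : G) : descPure K f (pure K r s σ) = f σ r s := by
  simp [descPure, pure, desc_incl]

/-- `pure` as a bilinear map in its first two arguments. -/
def pureBilin (σ : G) : R →ₗ[K] R →ₗ[K] Bowtie K R G :=
  ((TensorProduct.mk K R Rᵐᵒᵖ).compl₂ (opLinearEquiv K).toLinearMap).compr₂ (incl K R σ)

theorem pureBilin_apply (r s : R) (σ : G) : pureBilin K σ r s = pure K r s σ := rfl

variable [Group G] [MulSemiringAction G R] [SMulCommClass G K R]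

theorem pure_mul_pure (r s p q : R) (σ τ : G) :
    pure K r s σ * pure K p q τ = pure K (r * σ • p) (q * τ⁻¹ • s) (σ * τ) := by
  refine (mulMap_incl K σ τ _ _).trans ?_
  simp [actL, actR, pure]

omit [MulSemiringAction G R] [SMulCommClass G K R] in
theorem one_eq_pure : (1 : Bowtie K R G) = pure K 1 1 1 := rfl

/-- The algebra homomorphism out of `R^e ⋈ G` given by its values on the elements `r ⊗ s̄ ⋈ σ`. -/
def liftAlgHom {C : Type*} [Ring C] [Algebra K C] (f : G → (R →ₗ[K] R →ₗ[K] C))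
    (h_one : f 1 1 1 = 1)
    (h_mul : ∀ r s p q σ τ, f (σ * τ) (r * σ • p) (q * τ⁻¹ • s) = f σ r s * f τ p q) :
    Bowtie K R G →ₐ[K] C :=
  AlgHom.ofLinearMap (descPure K f) ((descPure_pure K f 1 1 1).trans h_one) <| by
    have : (LinearMap.mul K (Bowtie K R G)).compr₂ (descPure K f) =
        (LinearMap.mul K C).compl₁₂ (descPure K f) (descPure K f) :=
      hom_ext_pure fun r s σ => hom_ext_pure fun p q τ => by
        simp [pure_mul_pure, descPure_pure, h_mul]
    exact fun a b => congr($this a b)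

theorem liftAlgHom_pure {C : Type*} [Ring C] [Algebra K C] (f : G → (R →ₗ[K] R →ₗ[K] C))
    (h_one : f 1 1 1 = 1)
    (h_mul : ∀ r s p q σ τ, f (σ * τ) (r * σ • p) (q * τ⁻¹ • s) = f σ r s * f τ p q)
    (r s : R) (σ : G) : liftAlgHom K f h_one h_mul (pure K r s σ) = f σ r s :=
  descPure_pure K f r s σ

/-- `r ↦ r ⊗ 1 ⋈ e`. -/
def source : R →ₐ[K] Bowtie K R G :=
  AlgHom.ofLinearMap ((pureBilin K 1).flip 1) rfl fun r r' => by
    simp [pureBilin_apply, pure_mul_pure]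

/-- `r̄ ↦ 1 ⊗ r̄ ⋈ e`. -/
def target : Rᵐᵒᵖ →ₐ[K] Bowtie K R G :=
  AlgHom.ofLinearMap (pureBilin K 1 1 ∘ₗ (opLinearEquiv K).symm.toLinearMap) rfl fun r r' => by
    simp [pureBilin_apply, pure_mul_pure]

theorem source_apply (r : R) : source K r = (pure K r 1 1 : Bowtie K R G) := rfl

theorem target_op (r : R) : target K (op r) = (pure K 1 r 1 : Bowtie K R G) := rfl

/-- `r ⊗ s̄ ⋈ σ ↦ r σ(s)`. -/
def counit : Bowtie K R G →ₗ[K] R :=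
  descPure K fun σ => (LinearMap.mul K R).compl₂ (MulSemiringAction.toAlgHom K R σ).toLinearMap

theorem counit_pure (r s : R) (σ : G) : counit K (pure K r s σ) = r * σ • s := by
  simp [counit, descPure_pure]

/-- `r ⊗ s̄ ⋈ σ ↦ (r ⊗ 1 ⋈ σ) ⊗_R (1 ⊗ s̄ ⋈ σ)`. -/
def comul : Bowtie K R G →ₗ[K] Tensor₂ (source K (R := R) (G := G)) (target K) :=
  descPure K fun σ => ((TensorProduct.mk K (Bowtie K R G) (Bowtie K R G)).compl₁₂
    ((pureBilin K σ).flip 1) (pureBilin K σ 1)).compr₂ (mk₂ (source K) (target K))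

theorem comul_pure (r s : R) (σ : G) : comul K (pure K r s σ) =
    mk₂ (source K) (target K) (pure K r 1 σ ⊗ₜ[K] pure K 1 s σ) := by
  simp [comul, descPure_pure, pureBilin_apply]

/-- `r ⊗ s̄ ⋈ σ ↦ s ⊗ r̄ ⋈ σ⁻¹`, as a linear endomorphism. -/
def antipodeLin : Bowtie K R G →ₗ[K] Bowtie K R G :=
  descPure K fun σ => (pureBilin K σ⁻¹).flip

theorem antipodeLin_pure (r s : R) (σ : G) :
    antipodeLin K (pure K r s σ) = pure K s r σ⁻¹ := by
  simp [antipodeLin, descPure_pure, pureBilin_apply]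

theorem antipodeLin_antipodeLin (c : Bowtie K R G) : antipodeLin K (antipodeLin K c) = c := by
  have : antipodeLin K ∘ₗ antipodeLin K = (LinearMap.id : Bowtie K R G →ₗ[K] _) :=
    hom_ext_pure fun r s σ => by simp [antipodeLin_pure]
  exact congr($this c)

theorem antipodeLin_mul (c d : Bowtie K R G) :
    antipodeLin K (c * d) = antipodeLin K d * antipodeLin K c := by
  have : (LinearMap.mul K (Bowtie K R G)).compr₂ (antipodeLin K) =
      ((LinearMap.mul K (Bowtie K R G)).compl₁₂ (antipodeLin K) (antipodeLin K)).flip :=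
    hom_ext_pure fun r s σ => hom_ext_pure fun p q τ => by
      simp [pure_mul_pure, antipodeLin_pure]
  exact congr($this c d)

/-- The antipode `r ⊗ s̄ ⋈ σ ↦ s ⊗ r̄ ⋈ σ⁻¹`, as an isomorphism onto the opposite algebra. -/
def antipode : Bowtie K R G ≃ₐ[K] (Bowtie K R G)ᵐᵒᵖ where
  toFun c := op (antipodeLin K c)
  invFun c := antipodeLin K (unop c)
  left_inv c := antipodeLin_antipodeLin K c
  right_inv c := congr(op $(antipodeLin_antipodeLin K (unop c)))
  map_mul' c d := congr(op $(antipodeLin_mul K c d))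
  map_add' c d := congr(op $(map_add (antipodeLin K) c d))
  commutes' k := by
    simp only [Algebra.algebraMap_eq_smul_one, map_smul, one_eq_pure, antipodeLin_pure, inv_one]
    rfl

theorem antipode_apply (c : Bowtie K R G) : antipode K c = op (antipodeLin K c) := rfl

/-- A condition on the representatives of `Δ(c)` that is balanced over `R` needs to be checked only
on the representatives `(r ⊗ 1 ⋈ σ) ⊗ (1 ⊗ s̄ ⋈ σ)` of `Δ(r ⊗ s̄ ⋈ σ)`. -/
theorem apply_eq_of_mk₂_eq_comul {M : Type*} [AddCommGroup M] [Module K M]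
    {f : Bowtie K R G ⊗[K] Bowtie K R G →ₗ[K] M} {g : Bowtie K R G →ₗ[K] M}
    (hf : ∀ (r : R) (c d : Bowtie K R G),
      f ((target K (op r) * c) ⊗ₜ[K] d) = f (c ⊗ₜ[K] (source K r * d)))
    (hfg : ∀ r s σ, f (pure K r 1 σ ⊗ₜ[K] pure K 1 s σ) = g (pure K r s σ))
    {c : Bowtie K R G} {w : Bowtie K R G ⊗[K] Bowtie K R G}
    (h : mk₂ (source K) (target K) w = comul K c) : f w = g c := by
  rw [apply_eq_liftQ_of_mk₂_eq _ _ hf h]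
  have : (rel₂ (source K) (target K)).liftQ f (rel₂_le_ker _ _ hf) ∘ₗ comul K = g :=
    hom_ext_pure fun r s σ => by
      rw [LinearMap.comp_apply, comul_pure]
      exact (Submodule.liftQ_apply _ _ _).trans (hfg r s σ)
  exact congr($this c)

theorem source_target_comm (r r' : R) : source K r * target K (op r') =
    (target K (op r') * source K r : Bowtie K R G) := by
  simp [source_apply, target_op, pure_mul_pure]

theorem takeuchi (c : Bowtie K R G) (r : R) :
    act₂ (source K) (target K) (comul K c) (target K (op r) ⊗ₜ[K] 1) =
      act₂ (source K) (target K) (comul K c) (1 ⊗ₜ[K] source K r) := by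
  have : (act₂ (source K) (target K)).flip (target K (op r) ⊗ₜ[K] 1) ∘ₗ comul K =
      (act₂ (source K) (target K)).flip (1 ⊗ₜ[K] source K r) ∘ₗ comul (R := R) (G := G) K :=
    hom_ext_pure fun u v σ => by
      -- both sides are `(u ⊗ r̄ ⋈ σ) ⊗_R (1 ⊗ v̄ ⋈ σ)`, up to moving `σ(r)` across the tensor sign
      have := mk₂_balanced (source K) (target K) (σ • r) (pure K u 1 σ) (pure K 1 v σ)
      rw [target_op, source_apply] at this
      rw [LinearMap.comp_apply, LinearMap.comp_apply, LinearMap.flip_apply, LinearMap.flip_apply,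
        comul_pure, act₂_mk, act₂_mk, target_op, source_apply]
      simpa [pure_mul_pure, -Submodule.mkQ_apply] using this
  exact congr($this c)

theorem comul_mul (c d : Bowtie K R G) (w : Bowtie K R G ⊗[K] Bowtie K R G)
    (h : mk₂ (source K) (target K) w = comul K d) :
    comul K (c * d) = act₂ (source K) (target K) (comul K c) w := by
  refine (apply_eq_of_mk₂_eq_comul K (f := act₂ (source K) (target K) (comul K c))
    (g := comul K ∘ₗ LinearMap.mulLeft K c)
    (fun r a b => act₂_balanced _ _ (takeuchi K c r) a b) (fun p q τ => ?_) h).symm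
  have : (act₂ (source K) (target K)).flip (pure K p 1 τ ⊗ₜ[K] pure K 1 q τ) ∘ₗ comul K =
      comul K ∘ₗ LinearMap.mulRight K (pure K p q τ) :=
    hom_ext_pure fun r s σ => by
      rw [LinearMap.comp_apply, LinearMap.comp_apply, LinearMap.flip_apply, comul_pure, act₂_mk]
      simp [comul_pure, pure_mul_pure, -Submodule.mkQ_apply]
  exact congr($this c)

theorem counit_mul_source (c d : Bowtie K R G) :
    counit K (c * d) = counit K (c * source K (counit K d)) := by
  have : (LinearMap.mul K (Bowtie K R G)).compr₂ (counit K) =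
      ((LinearMap.mul K (Bowtie K R G)).compl₂
        ((source K).toLinearMap ∘ₗ counit K)).compr₂ (counit K) :=
    hom_ext_pure fun r s σ => hom_ext_pure fun p q τ => by
      simp [pure_mul_pure, counit_pure, source_apply, mul_smul, mul_assoc]
  exact congr($this c d)

theorem counit_mul_target (c d : Bowtie K R G) :
    counit K (c * d) = counit K (c * target K (op (counit K d))) := by
  have : (LinearMap.mul K (Bowtie K R G)).compr₂ (counit K) =
      ((LinearMap.mul K (Bowtie K R G)).compl₂ ((target K).toLinearMap ∘ₗ
        (opLinearEquiv K).toLinearMap ∘ₗ counit K)).compr₂ (counit K) :=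
    hom_ext_pure fun r s σ => hom_ext_pure fun p q τ => by
      change counit K (pure K r s σ * pure K p q τ) =
        counit K (pure K r s σ * pure K 1 (counit K (pure K p q τ)) 1)
      simp [pure_mul_pure, counit_pure, mul_smul, mul_assoc]
  exact congr($this c d)

theorem counit_bimod (r r' : R) (c : Bowtie K R G) :
    counit K (source K r * target K (op r') * c) = r * counit K c * r' := by
  have : counit K ∘ₗ LinearMap.mulLeft K (source K r * target K (op r')) =
      LinearMap.mulRight K r' ∘ₗ LinearMap.mulLeft K r ∘ₗ counit (R := R) (G := G) K :=
    hom_ext_pure fun u v σ => by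
      simp [pure_mul_pure, counit_pure, source_apply, target_op, mul_assoc]
  exact congr($this c)

theorem comul_bimod (r r' : R) (c : Bowtie K R G) (w : Bowtie K R G ⊗[K] Bowtie K R G)
    (h : mk₂ (source K) (target K) w = comul K c) :
    comul K (source K r * target K (op r') * c) =
      mk₂ (source K) (target K) ((source K r ⊗ₜ[K] target K (op r')) * w) := by
  refine (apply_eq_of_mk₂_eq_comul K
    (f := mk₂ (source K) (target K) ∘ₗ LinearMap.mulLeft K
      ((source K r : Bowtie K R G) ⊗ₜ[K] (target K (op r') : Bowtie K R G)))
    (g := comul K ∘ₗ LinearMap.mulLeft K (source K r * target K (op r')))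
    (fun p a b => ?_) (fun p q τ => ?_) h).symm
  · have := mk₂_balanced (source K) (target K) p (source K r * a) (target K (op r') * b)
    rw [← mul_assoc, ← mul_assoc, ← source_target_comm, source_target_comm K p r'] at this
    simpa only [LinearMap.comp_apply, LinearMap.mulLeft_apply, Algebra.TensorProduct.tmul_mul_tmul,
      mul_assoc] using this
  · rw [LinearMap.comp_apply, LinearMap.comp_apply, LinearMap.mulLeft_apply,
      LinearMap.mulLeft_apply, Algebra.TensorProduct.tmul_mul_tmul, source_apply, target_op,
      pure_mul_pure, pure_mul_pure, pure_mul_pure, pure_mul_pure, comul_pure]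
    simp [-Submodule.mkQ_apply]

theorem comul_target_mul (r : R) (c : Bowtie K R G) (w : Bowtie K R G ⊗[K] Bowtie K R G)
    (h : mk₂ (source K) (target K) w = comul K c) :
    comul K (target K (op r) * c) =
      mk₂ (source K) (target K) ((1 ⊗ₜ[K] target K (op r)) * w) := by
  simpa only [map_one, one_mul] using comul_bimod K 1 r c w h

theorem comul_source_mul (r : R) (c : Bowtie K R G) (w : Bowtie K R G ⊗[K] Bowtie K R G)
    (h : mk₂ (source K) (target K) w = comul K c) :
    comul K (source K r * c) = mk₂ (source K) (target K) ((source K r ⊗ₜ[K] 1) * w) := by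
  simpa only [op_one, map_one, mul_one] using comul_bimod K r 1 c w h

theorem lift_joinLeft_balanced (r : R) (a b : Bowtie K R G) :
    joinLeft (source K) (target K) (comul K (target K (op r) * a)) b =
      joinLeft (source K) (target K) (comul K a) (source K r * b) := by
  obtain ⟨v, hv⟩ := (rel₂ (source K) (target K)).mkQ_surjective (comul K a)
  rw [comul_target_mul K r a v hv, joinLeft_target_mul, hv]

theorem lift_joinRight_balanced (r : R) (a b : Bowtie K R G) :
    joinRight (source K) (target K) (comul K b) (target K (op r) * a) =
      joinRight (source K) (target K) (comul K (source K r * b)) a := by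
  obtain ⟨v, hv⟩ := (rel₂ (source K) (target K)).mkQ_surjective (comul K b)
  rw [comul_source_mul K r b v hv, joinRight_source_mul, hv]

theorem coassoc (c : Bowtie K R G) (w : Bowtie K R G ⊗[K] Bowtie K R G)
    (h : mk₂ (source K) (target K) w = comul K c) :
    TensorProduct.lift (joinLeft (source K) (target K) ∘ₗ comul K) w =
      TensorProduct.lift (joinRight (source K) (target K) ∘ₗ comul K).flip w := by
  -- both sides send `r ⊗ s̄ ⋈ σ` to `(r ⊗ 1 ⋈ σ) ⊗_R (1 ⊗ 1 ⋈ σ) ⊗_R (1 ⊗ s̄ ⋈ σ)`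
  have h₁ : ∀ (r : R) (a b : Bowtie K R G),
      TensorProduct.lift (joinLeft (source K) (target K) ∘ₗ comul K)
        ((target K (op r) * a) ⊗ₜ[K] b) =
      TensorProduct.lift (joinLeft (source K) (target K) ∘ₗ comul K)
        (a ⊗ₜ[K] (source K r * b)) := lift_joinLeft_balanced K
  have h₂ : ∀ (r : R) (a b : Bowtie K R G),
      TensorProduct.lift (joinRight (source K) (target K) ∘ₗ comul K).flip
        ((target K (op r) * a) ⊗ₜ[K] b) =
      TensorProduct.lift (joinRight (source K) (target K) ∘ₗ comul K).flip
        (a ⊗ₜ[K] (source K r * b)) := lift_joinRight_balanced K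
  rw [← sub_eq_zero, ← LinearMap.sub_apply]
  refine apply_eq_of_mk₂_eq_comul K (g := 0) (fun r a b => ?_) (fun r s σ => ?_) h
  · rw [LinearMap.sub_apply, LinearMap.sub_apply, h₁, h₂]
  · rw [LinearMap.sub_apply, TensorProduct.lift.tmul, TensorProduct.lift.tmul,
      LinearMap.flip_apply, LinearMap.comp_apply, LinearMap.comp_apply, comul_pure, comul_pure,
      joinLeft_mk, joinRight_mk, TensorProduct.assoc_symm_tmul, sub_self, LinearMap.zero_apply]

theorem counit_left (c : Bowtie K R G) (w : Bowtie K R G ⊗[K] Bowtie K R G)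
    (h : mk₂ (source K) (target K) w = comul K c) :
    TensorProduct.lift ((LinearMap.mul K (Bowtie K R G)) ∘ₗ (source K).toLinearMap ∘ₗ
      counit K) w = c := by
  refine apply_eq_of_mk₂_eq_comul K (g := LinearMap.id) (fun r a b => ?_) (fun r s σ => ?_) h
  · change source K (counit K (target K (op r) * a)) * b = source K (counit K a) * (source K r * b)
    have := counit_bimod K 1 r a
    rw [map_one, one_mul, one_mul] at this
    rw [this, map_mul, mul_assoc]
  · change source K (counit K (pure K r 1 σ)) * pure K 1 s σ = pure K r s σ
    simp [counit_pure, source_apply, pure_mul_pure]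

theorem counit_right (c : Bowtie K R G) (w : Bowtie K R G ⊗[K] Bowtie K R G)
    (h : mk₂ (source K) (target K) w = comul K c) :
    TensorProduct.lift ((LinearMap.mul K (Bowtie K R G)) ∘ₗ (target K).toLinearMap ∘ₗ
      (opLinearEquiv K).toLinearMap ∘ₗ counit K).flip w = c := by
  refine apply_eq_of_mk₂_eq_comul K (g := LinearMap.id) (fun r a b => ?_) (fun r s σ => ?_) h
  · change target K (op (counit K b)) * (target K (op r) * a) =
      target K (op (counit K (source K r * b))) * a
    have := counit_bimod K r 1 b
    rw [op_one, map_one, mul_one, mul_one] at this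
    rw [this, op_mul, map_mul, mul_assoc]
  · change target K (op (counit K (pure K 1 s σ))) * pure K r 1 σ = pure K r s σ
    rw [counit_pure, target_op, pure_mul_pure]
    simp

/-- The left bialgebroid `R^e ⋈ G` over `R`. -/
def leftBialgebroid : LeftBialgebroid K R (Bowtie K R G) where
  source := source K
  target := target K
  source_target_comm := source_target_comm K
  counit := counit K
  comul := comul K
  counit_bimod := counit_bimod K
  comul_bimod := comul_bimod K
  coassoc := coassoc K
  counit_left := counit_left K
  counit_right := counit_right K
  counit_one := by rw [one_eq_pure, counit_pure, one_mul, smul_one]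
  comul_one := by rw [one_eq_pure, comul_pure]
  takeuchi := takeuchi K
  comul_mul := comul_mul K
  counit_mul_source := counit_mul_source K
  counit_mul_target := counit_mul_target K

theorem antipode_target (r : R) :
    antipode K (target K (op r)) = op (source K r : Bowtie K R G) := by
  rw [antipode_apply, target_op, antipodeLin_pure, inv_one, source_apply]

theorem antipodeLin_target_mul (r : R) (c : Bowtie K R G) :
    antipodeLin K (target K (op r) * c) = antipodeLin K c * source K r := by
  rw [antipodeLin_mul, target_op, antipodeLin_pure, inv_one, source_apply]

theorem antipodeLin_source_mul (r : R) (c : Bowtie K R G) :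
    antipodeLin K (source K r * c) = antipodeLin K c * target K (op r) := by
  rw [antipodeLin_mul, target_op, source_apply, antipodeLin_pure, inv_one]

theorem comul_mul_source (r : R) (c : Bowtie K R G) :
    comul K (c * source K r) =
      act₂ (source K) (target K) (comul K c) (source K r ⊗ₜ[K] 1) := by
  refine comul_mul K c _ _ ?_
  rw [source_apply, comul_pure, one_eq_pure]

theorem comul_mul_target (r : R) (c : Bowtie K R G) :
    comul K (c * target K (op r)) =
      act₂ (source K) (target K) (comul K c) (1 ⊗ₜ[K] target K (op r)) := by
  refine comul_mul K c _ _ ?_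
  rw [target_op, comul_pure, one_eq_pure]

theorem antipode_symm_comul (c : Bowtie K R G) (w : Bowtie K R G ⊗[K] Bowtie K R G)
    (h : mk₂ (source K) (target K) w = comul K c) :
    TensorProduct.lift (((act₂ (source K) (target K) ∘ₗ comul K ∘ₗ
      (antipode K).symm.toLinearMap ∘ₗ (opLinearEquiv K).toLinearMap).compl₂
        (TensorProduct.mk K (Bowtie K R G) (Bowtie K R G) 1)).flip) w =
      mk₂ (source K) (target K) ((antipode K).symm (op c) ⊗ₜ[K] 1) := by
  refine apply_eq_of_mk₂_eq_comul K (g := mk₂ (source K) (target K) ∘ₗ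
    (TensorProduct.mk K (Bowtie K R G) (Bowtie K R G)).flip 1 ∘ₗ antipodeLin K)
    (fun r a b => ?_) (fun r s σ => ?_) h
  · change act₂ (source K) (target K) (comul K (antipodeLin K b))
        (1 ⊗ₜ[K] (target K (op r) * a)) =
      act₂ (source K) (target K) (comul K (antipodeLin K (source K r * b))) (1 ⊗ₜ[K] a)
    rw [antipodeLin_source_mul, comul_mul_target, act₂_act₂,
      Algebra.TensorProduct.tmul_mul_tmul, one_mul]
  · change act₂ (source K) (target K) (comul K (antipodeLin K (pure K 1 s σ)))
        (1 ⊗ₜ[K] pure K r 1 σ) =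
      mk₂ (source K) (target K) (antipodeLin K (pure K r s σ) ⊗ₜ[K] 1)
    -- the left side is `(s ⊗ 1 ⋈ σ⁻¹) ⊗_R s(σ⁻¹(r))`
    have := mk₂_balanced (source K) (target K) (σ⁻¹ • r) (pure K s 1 σ⁻¹)
      (1 : Bowtie K R G)
    rw [target_op, source_apply, pure_mul_pure, mul_one] at this
    rw [antipodeLin_pure, antipodeLin_pure, comul_pure, act₂_mk,
      Algebra.TensorProduct.tmul_mul_tmul, pure_mul_pure]
    simpa [-Submodule.mkQ_apply] using this.symm

theorem antipode_comul (c : Bowtie K R G) (w : Bowtie K R G ⊗[K] Bowtie K R G)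
    (h : mk₂ (source K) (target K) w = comul K c) :
    TensorProduct.lift ((act₂ (source K) (target K) ∘ₗ comul K ∘ₗ
      (opLinearEquiv K).symm.toLinearMap ∘ₗ (antipode K).toLinearMap).compl₂
        ((TensorProduct.mk K (Bowtie K R G) (Bowtie K R G)).flip 1)) w =
      mk₂ (source K) (target K) (1 ⊗ₜ[K] unop (antipode K c)) := by
  refine apply_eq_of_mk₂_eq_comul K (g := mk₂ (source K) (target K) ∘ₗ
    TensorProduct.mk K (Bowtie K R G) (Bowtie K R G) 1 ∘ₗ antipodeLin K)
    (fun r a b => ?_) (fun r s σ => ?_) h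
  · change act₂ (source K) (target K) (comul K (antipodeLin K (target K (op r) * a)))
        (b ⊗ₜ[K] 1) =
      act₂ (source K) (target K) (comul K (antipodeLin K a)) ((source K r * b) ⊗ₜ[K] 1)
    rw [antipodeLin_target_mul, comul_mul_source, act₂_act₂,
      Algebra.TensorProduct.tmul_mul_tmul, one_mul]
  · change act₂ (source K) (target K) (comul K (antipodeLin K (pure K r 1 σ)))
        (pure K 1 s σ ⊗ₜ[K] 1) =
      mk₂ (source K) (target K) (1 ⊗ₜ[K] antipodeLin K (pure K r s σ))
    -- the left side is `t(s) ⊗_R (1 ⊗ r̄ ⋈ σ⁻¹)`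
    have := mk₂_balanced (source K) (target K) s (1 : Bowtie K R G) (pure K 1 r σ⁻¹)
    rw [target_op, source_apply, pure_mul_pure, mul_one] at this
    rw [antipodeLin_pure, antipodeLin_pure, comul_pure, act₂_mk,
      Algebra.TensorProduct.tmul_mul_tmul, pure_mul_pure]
    simpa [-Submodule.mkQ_apply] using this

/-- The Hopf algebroid `R^e ⋈ G` over `R`. -/
def hopfAlgebroid : HopfAlgebroid K R (Bowtie K R G) where
  __ := leftBialgebroid K
  antipode := antipode K
  antipode_target := antipode_target K
  antipode_symm_comul := antipode_symm_comul K
  antipode_comul := antipode_comul K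

end Bowtie

/-! ### Bialgebroids of endomorphisms -/

/-- A faithful realization of a `K`-algebra `C` by endomorphisms of `A`, in which `R` acts through
`s` and `t` by left and right multiplications, together with elements `t_i = t_i¹ ⊗ t_i²` of `A ⊗ A`
and `β_i` of `C` such that `C` is stable under the operations `c ↦ c(? t_i¹) t_i²` and
`∑ c(x t_i¹) t_i² β_i(y) = c(x y)`. The algebra `End(_B A_B)` has this form whenever `A ‖ B` has
left depth two quasibases. -/
structure QuasibasisRep {K R C : Type*} [CommRing K] [Ring R] [Algebra K R] [Ring C] [Algebra K C]
    (s : R →ₐ[K] C) (t : Rᵐᵒᵖ →ₐ[K] C) (A : Type*) [Ring A] [Algebra K A] where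
  toEnd : C →ₐ[K] Module.End K A
  toEnd_injective : Function.Injective toEnd
  base : R →ₐ[K] A
  base_injective : Function.Injective base
  toEnd_source : ∀ r x, toEnd (s r) x = base r * x
  toEnd_target : ∀ r x, toEnd (t (op r)) x = x * base r
  counit : C →ₗ[K] R
  base_counit : ∀ c, base (counit c) = toEnd c 1
  n : ℕ
  tens : Fin n → A ⊗[K] A
  /-- The operation `c ↦ c(? t_i¹) t_i²`. -/
  insert : Fin n → C →ₗ[K] C
  toEnd_insert : ∀ i c x, toEnd (insert i c) x =
    LinearMap.mul' K A (TensorProduct.map (toEnd c ∘ₗ LinearMap.mulLeft K x) LinearMap.id (tens i))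
  gen : Fin n → C
  sum_insert_mul : ∀ c x y, ∑ i, toEnd (insert i c) x * toEnd (gen i) y = toEnd c (x * y)

namespace QuasibasisRep

variable {K R C A : Type*} [CommRing K] [Ring R] [Algebra K R] [Ring C] [Algebra K C] [Ring A]
  [Algebra K A] {s : R →ₐ[K] C} {t : Rᵐᵒᵖ →ₐ[K] C} (D : QuasibasisRep s t A)

theorem toEnd_ext {c d : C} (h : ∀ x, D.toEnd c x = D.toEnd d x) : c = d :=
  D.toEnd_injective (LinearMap.ext h)

/-- Evaluation `c ↦ c(x)`. -/
def ev (x : A) : C →ₗ[K] A := LinearMap.applyₗ x ∘ₗ D.toEnd.toLinearMap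

/-- The coefficient `c ↦ c(t_i¹) t_i² ∈ R` of `β_i` in the expansion of `c`. -/
def coeff (i : Fin D.n) : C →ₗ[K] R := D.counit ∘ₗ D.insert i

/-- `C` is generated by the `β_i` as a left `R`-module. -/
theorem sum_source_coeff_mul (c : C) : ∑ i, s (D.coeff i c) * D.gen i = c := by
  refine D.toEnd_ext fun x => ?_
  have h := D.sum_insert_mul c 1 x
  rw [one_mul] at h
  rw [← h, map_sum, LinearMap.sum_apply]
  refine Finset.sum_congr rfl fun i _ => ?_
  rw [map_mul, Module.End.mul_apply, D.toEnd_source, coeff, LinearMap.comp_apply, D.base_counit]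

/-- As `C` is generated by the `β_i` over `R`, a subalgebra containing these and `s(R)` is `C`. -/
theorem surjective_of_mem_range {H : Type*} [Ring H] [Algebra K H] (Ψ : H →ₐ[K] C)
    (hs : ∀ r, s r ∈ Ψ.range) (hgen : ∀ i, D.gen i ∈ Ψ.range) : Function.Surjective Ψ := fun c => by
  rw [← AlgHom.mem_range, ← D.sum_source_coeff_mul c]
  exact sum_mem fun i _ => mul_mem (hs _) (hgen i)

/-- `c(t_i¹) t_i²` as a linear map in `c` with values in `A`. -/
def coeffBase (i : Fin D.n) : C →ₗ[K] A := D.base.toLinearMap ∘ₗ D.coeff i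

/-- If all products `φ(w₁) w₂(z)` with `z ∈ A` vanish, so do all `φ(w₁) w₂(t_i¹) t_i²`. -/
theorem mul_map_coeffBase_eq_zero {X : Type*} [AddCommGroup X] [Module K X] (φ : X →ₗ[K] A)
    (w : X ⊗[K] C) (h : ∀ z, LinearMap.mul' K A (TensorProduct.map φ (D.ev z) w) = 0)
    (i : Fin D.n) : LinearMap.mul' K A (TensorProduct.map φ (D.coeffBase i) w) = 0 := by
  -- the form `c ↦ c(v¹) v²` on `C`, for `v ∈ A ⊗ A`
  let e : A ⊗[K] A →ₗ[K] C →ₗ[K] A := TensorProduct.lift <| LinearMap.mk₂ K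
    (fun p q => LinearMap.mulRight K q ∘ₗ D.ev p)
    (fun _ _ _ => LinearMap.ext fun _ => by simp [ev, add_mul])
    (fun _ _ _ => LinearMap.ext fun _ => by simp [ev])
    (fun _ _ _ => LinearMap.ext fun _ => by simp [mul_add])
    (fun _ _ _ => LinearMap.ext fun _ => by simp)
  have he : D.coeffBase i = e (D.tens i) := LinearMap.ext fun c => by
    change D.base (D.counit (D.insert i c)) = _
    rw [D.base_counit, D.toEnd_insert]
    generalize D.tens i = v
    induction v using TensorProduct.induction_on with
    | zero => simp
    | add v v' hv hv' => rw [map_add, map_add, map_add, LinearMap.add_apply, hv, hv']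
    | tmul p q => simp [e, ev]
  rw [he]
  generalize D.tens i = v
  induction v using TensorProduct.induction_on with
  | zero => simp
  | add v v' hv hv' =>
    rw [map_add, TensorProduct.map_add_right, LinearMap.add_apply, map_add, hv, hv', add_zero]
  | tmul p q =>
    have : LinearMap.mul' K A ∘ₗ TensorProduct.map φ (e (p ⊗ₜ[K] q)) =
        LinearMap.mulRight K q ∘ₗ LinearMap.mul' K A ∘ₗ TensorProduct.map φ (D.ev p) :=
      TensorProduct.ext' fun x c => by simp [e, mul_assoc]
    refine congr($this w).trans ?_
    rw [LinearMap.comp_apply, LinearMap.comp_apply, h p, map_zero]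

/-- `c ⊗ d ↦ c(x) d(y)`. -/
def evPair (x y : A) : C ⊗[K] C →ₗ[K] A :=
  LinearMap.mul' K A ∘ₗ TensorProduct.map (D.ev x) (D.ev y)

theorem evPair_tmul (x y : A) (c d : C) :
    D.evPair x y (c ⊗ₜ[K] d) = D.toEnd c x * D.toEnd d y := rfl

theorem evPair_balanced (x y : A) (r : R) (c d : C) :
    D.evPair x y ((t (op r) * c) ⊗ₜ[K] d) = D.evPair x y (c ⊗ₜ[K] (s r * d)) := by
  rw [evPair_tmul, evPair_tmul, map_mul, map_mul, Module.End.mul_apply, Module.End.mul_apply,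
    D.toEnd_source, D.toEnd_target, mul_assoc]

/-- `c ⊗_R d ↦ c(x) d(y)`. -/
def pairing₂ (x y : A) : Tensor₂ s t →ₗ[K] A :=
  (rel₂ s t).liftQ (D.evPair x y) (rel₂_le_ker s t (D.evPair_balanced x y))

theorem pairing₂_mk (x y : A) (w : C ⊗[K] C) : D.pairing₂ x y (mk₂ s t w) = D.evPair x y w := rfl

/-- `c ⊗ d ⊗ e ↦ c(x) d(y) e(z)`. -/
def evTriple (x y z : A) : (C ⊗[K] C) ⊗[K] C →ₗ[K] A :=
  LinearMap.mul' K A ∘ₗ TensorProduct.map (D.evPair x y) (D.ev z)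

theorem evTriple_tmul (x y z : A) (w : C ⊗[K] C) (c : C) :
    D.evTriple x y z (w ⊗ₜ[K] c) = D.evPair x y w * D.toEnd c z := rfl

/-- `c ⊗_R d ⊗_R e ↦ c(x) d(y) e(z)`. -/
def pairing₃ (x y z : A) : Tensor₃ s t →ₗ[K] A :=
  (rel₃ s t).liftQ (D.evTriple x y z) <| by
    refine Submodule.span_le.2 ?_
    rintro _ (⟨r, c, d, e, rfl⟩ | ⟨r, c, d, e, rfl⟩)
    · rw [SetLike.mem_coe, LinearMap.mem_ker, map_sub, evTriple_tmul, evTriple_tmul,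
        evPair_balanced, sub_self]
    · simp [LinearMap.mem_ker, evTriple_tmul, evPair_tmul, D.toEnd_source, D.toEnd_target,
        mul_assoc]

theorem pairing₃_mk (x y z : A) (w : (C ⊗[K] C) ⊗[K] C) :
    D.pairing₃ x y z ((rel₃ s t).mkQ w) = D.evTriple x y z w := rfl

theorem pairing₃_joinLeft (x y z : A) (u : Tensor₂ s t) (c : C) :
    D.pairing₃ x y z (joinLeft s t u c) = D.pairing₂ x y u * D.toEnd c z := by
  obtain ⟨w, rfl⟩ := (rel₂ s t).mkQ_surjective u
  rfl

theorem pairing₃_joinRight (x y z : A) (u : Tensor₂ s t) (c : C) :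
    D.pairing₃ x y z (joinRight s t u c) = D.toEnd c x * D.pairing₂ y z u := by
  obtain ⟨w, rfl⟩ := (rel₂ s t).mkQ_surjective u
  rw [joinRight_mk, pairing₃_mk, pairing₂_mk]
  induction w using TensorProduct.induction_on with
  | zero => simp
  | add w w' h h' => simp only [TensorProduct.tmul_add, map_add, mul_add, h, h']
  | tmul d e => rw [TensorProduct.assoc_symm_tmul, evTriple_tmul, evPair_tmul, evPair_tmul,
      mul_assoc]

theorem pairing₂_act₂ (x y : A) (u : Tensor₂ s t) (c d : C) :
    D.pairing₂ x y (act₂ s t u (c ⊗ₜ[K] d)) = D.pairing₂ (D.toEnd c x) (D.toEnd d y) u := by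
  obtain ⟨w, rfl⟩ := (rel₂ s t).mkQ_surjective u
  rw [act₂_mk, pairing₂_mk, pairing₂_mk]
  induction w using TensorProduct.induction_on with
  | zero => simp
  | add w w' h h' => simp only [add_mul, map_add, h, h']
  | tmul a b => rw [Algebra.TensorProduct.tmul_mul_tmul, evPair_tmul, evPair_tmul, map_mul,
      map_mul, Module.End.mul_apply, Module.End.mul_apply]

/-- The coefficient `c ⊗ d ↦ t(d(t_i¹) t_i²) c` of `β_i` in the expansion of `c ⊗_R d`. -/
def coeff₂ (i : Fin D.n) : C ⊗[K] C →ₗ[K] C :=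
  TensorProduct.lift (LinearMap.mul K C ∘ₗ t.toLinearMap ∘ₗ
    (opLinearEquiv K).toLinearMap ∘ₗ D.coeff i).flip

theorem coeff₂_tmul (i : Fin D.n) (c d : C) :
    D.coeff₂ i (c ⊗ₜ[K] d) = t (op (D.coeff i d)) * c := rfl

theorem mk₂_eq_sum (w : C ⊗[K] C) :
    mk₂ s t w = ∑ i, mk₂ s t (D.coeff₂ i w ⊗ₜ[K] D.gen i) := by
  induction w using TensorProduct.induction_on with
  | zero => simp
  | add w w' h h' => simp only [map_add, TensorProduct.add_tmul, Finset.sum_add_distrib, h, h']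
  | tmul c d =>
    simp only [coeff₂_tmul, mk₂_balanced]
    rw [← map_sum, ← TensorProduct.tmul_sum, D.sum_source_coeff_mul]

theorem toEnd_coeff₂ (i : Fin D.n) (w : C ⊗[K] C) (x : A) :
    D.toEnd (D.coeff₂ i w) x =
      LinearMap.mul' K A (TensorProduct.map (D.ev x) (D.coeffBase i) w) := by
  have : D.ev x ∘ₗ D.coeff₂ i =
      LinearMap.mul' K A ∘ₗ TensorProduct.map (D.ev x) (D.coeffBase i) :=
    TensorProduct.ext' fun c d => by
      change D.toEnd (t (op (D.coeff i d)) * c) x = _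
      rw [map_mul, Module.End.mul_apply, D.toEnd_target]
      rfl
  exact congr($this w)

/-- The pairings `c ⊗_R d ↦ c(x) d(y)` separate the elements of `C ⊗_R C`. -/
theorem tensor₂_ext {u u' : Tensor₂ s t}
    (h : ∀ x y, D.pairing₂ x y u = D.pairing₂ x y u') : u = u' := by
  rw [← sub_eq_zero]
  obtain ⟨w, hw⟩ := (rel₂ s t).mkQ_surjective (u - u')
  have h₀ : ∀ x y, D.evPair x y w = 0 := fun x y => by
    rw [← pairing₂_mk, mk₂, hw, map_sub, h, sub_self]
  rw [← hw, D.mk₂_eq_sum w]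
  refine Finset.sum_eq_zero fun i _ => ?_
  have : D.coeff₂ i w = 0 := D.toEnd_ext fun x => by
    rw [toEnd_coeff₂, D.mul_map_coeffBase_eq_zero (D.ev x) w (h₀ x), map_zero,
      LinearMap.zero_apply]
  rw [this, TensorProduct.zero_tmul, map_zero]

/-- The coefficient `w ⊗ c ↦ (1 ⊗ t(c(t_i¹) t_i²)) w` of `β_i` in the expansion of `w ⊗_R c`. -/
def coeff₃ (i : Fin D.n) : (C ⊗[K] C) ⊗[K] C →ₗ[K] C ⊗[K] C :=
  TensorProduct.lift (LinearMap.mul K (C ⊗[K] C) ∘ₗ TensorProduct.mk K C C 1 ∘ₗ t.toLinearMap ∘ₗ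
    (opLinearEquiv K).toLinearMap ∘ₗ D.coeff i).flip

theorem coeff₃_tmul (i : Fin D.n) (w : C ⊗[K] C) (c : C) :
    D.coeff₃ i (w ⊗ₜ[K] c) = (1 ⊗ₜ[K] t (op (D.coeff i c))) * w := rfl

theorem mk₃_eq_sum (w : (C ⊗[K] C) ⊗[K] C) :
    (rel₃ s t).mkQ w = ∑ i, joinLeft s t (mk₂ s t (D.coeff₃ i w)) (D.gen i) := by
  induction w using TensorProduct.induction_on with
  | zero => simp
  | add w w' h h' => simp only [map_add, LinearMap.add_apply, Finset.sum_add_distrib, h, h']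
  | tmul w c =>
    simp only [coeff₃_tmul, joinLeft_target_mul]
    rw [← map_sum, D.sum_source_coeff_mul, joinLeft_mk]

theorem evPair_coeff₃ (i : Fin D.n) (w : (C ⊗[K] C) ⊗[K] C) (x y : A) :
    D.evPair x y (D.coeff₃ i w) =
      LinearMap.mul' K A (TensorProduct.map (D.evPair x y) (D.coeffBase i) w) := by
  have : D.evPair x y ∘ₗ D.coeff₃ i =
      LinearMap.mul' K A ∘ₗ TensorProduct.map (D.evPair x y) (D.coeffBase i) := by
    refine TensorProduct.ext_threefold fun a b c => ?_
    rw [LinearMap.comp_apply, coeff₃_tmul, Algebra.TensorProduct.tmul_mul_tmul, one_mul,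
      evPair_tmul, map_mul, Module.End.mul_apply, D.toEnd_target, ← mul_assoc]
    rfl
  exact congr($this w)

/-- The pairings `c ⊗_R d ⊗_R e ↦ c(x) d(y) e(z)` separate the elements of `C ⊗_R C ⊗_R C`. -/
theorem tensor₃_ext {u u' : Tensor₃ s t}
    (h : ∀ x y z, D.pairing₃ x y z u = D.pairing₃ x y z u') : u = u' := by
  rw [← sub_eq_zero]
  obtain ⟨w, hw⟩ := (rel₃ s t).mkQ_surjective (u - u')
  have h₀ : ∀ x y z, D.evTriple x y z w = 0 := fun x y z => by
    rw [← pairing₃_mk, hw, map_sub, h, sub_self]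
  rw [← hw, D.mk₃_eq_sum w]
  refine Finset.sum_eq_zero fun i _ => ?_
  have : mk₂ s t (D.coeff₃ i w) = 0 := D.tensor₂_ext fun x y => by
    rw [pairing₂_mk, evPair_coeff₃, D.mul_map_coeffBase_eq_zero (D.evPair x y) w (h₀ x y),
      map_zero]
  rw [this, map_zero, LinearMap.zero_apply]

/-- The comultiplication `c ↦ ∑ c(? t_i¹) t_i² ⊗_R β_i`. -/
def comul : C →ₗ[K] Tensor₂ s t :=
  ∑ i, mk₂ s t ∘ₗ (TensorProduct.mk K C C).flip (D.gen i) ∘ₗ D.insert i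

/-- `Δ(c)` corresponds to the map `x ⊗ y ↦ c(x y)`, which determines it. -/
theorem pairing₂_comul (c : C) (x y : A) : D.pairing₂ x y (D.comul c) = D.toEnd c (x * y) := by
  rw [comul, LinearMap.sum_apply, map_sum, ← D.sum_insert_mul]
  rfl

theorem comul_eq_mk₂ {c : C} {w : C ⊗[K] C} (h : ∀ x y, D.evPair x y w = D.toEnd c (x * y)) :
    D.comul c = mk₂ s t w :=
  D.tensor₂_ext fun x y => by rw [pairing₂_comul, pairing₂_mk, h]

theorem evPair_of_mk₂_eq_comul {c : C} {w : C ⊗[K] C} (h : mk₂ s t w = D.comul c) (x y : A) :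
    D.evPair x y w = D.toEnd c (x * y) := by
  rw [← pairing₂_mk, h, pairing₂_comul]

theorem comul_bimod (r r' : R) (c : C) (w : C ⊗[K] C) (h : mk₂ s t w = D.comul c) :
    D.comul (s r * t (op r') * c) = mk₂ s t ((s r ⊗ₜ[K] t (op r')) * w) := by
  refine D.comul_eq_mk₂ fun x y => ?_
  have : D.evPair x y ∘ₗ LinearMap.mulLeft K (s r ⊗ₜ[K] t (op r')) =
      LinearMap.mulLeft K (D.base r) ∘ₗ LinearMap.mulRight K (D.base r') ∘ₗ D.evPair x y :=
    TensorProduct.ext' fun a b => by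
      simp [evPair_tmul, D.toEnd_source, D.toEnd_target, mul_assoc]
  rw [map_mul D.toEnd, map_mul D.toEnd, Module.End.mul_apply, Module.End.mul_apply,
    D.toEnd_source, D.toEnd_target, ← D.evPair_of_mk₂_eq_comul h]
  exact congr($this w)

theorem coassoc (c : C) (w : C ⊗[K] C) (h : mk₂ s t w = D.comul c) :
    TensorProduct.lift (joinLeft s t ∘ₗ D.comul) w =
      TensorProduct.lift (joinRight s t ∘ₗ D.comul).flip w := by
  refine D.tensor₃_ext fun x y z => ?_
  have h₁ : D.pairing₃ x y z ∘ₗ TensorProduct.lift (joinLeft s t ∘ₗ D.comul) =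
      D.evPair (x * y) z := TensorProduct.ext' fun a b => by
    rw [LinearMap.comp_apply, TensorProduct.lift.tmul, LinearMap.comp_apply, pairing₃_joinLeft,
      pairing₂_comul, evPair_tmul]
  have h₂ : D.pairing₃ x y z ∘ₗ TensorProduct.lift (joinRight s t ∘ₗ D.comul).flip =
      D.evPair x (y * z) := TensorProduct.ext' fun a b => by
    rw [LinearMap.comp_apply, TensorProduct.lift.tmul, LinearMap.flip_apply,
      LinearMap.comp_apply, pairing₃_joinRight, pairing₂_comul, evPair_tmul]
  refine congr($h₁ w).trans (Eq.trans ?_ congr($h₂ w).symm)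
  rw [D.evPair_of_mk₂_eq_comul h, D.evPair_of_mk₂_eq_comul h, mul_assoc]

theorem counit_left (c : C) (w : C ⊗[K] C) (h : mk₂ s t w = D.comul c) :
    TensorProduct.lift (LinearMap.mul K C ∘ₗ s.toLinearMap ∘ₗ D.counit) w = c := by
  refine D.toEnd_ext fun x => ?_
  have : D.ev x ∘ₗ TensorProduct.lift (LinearMap.mul K C ∘ₗ s.toLinearMap ∘ₗ D.counit) =
      D.evPair 1 x := TensorProduct.ext' fun a b => by
    change D.toEnd (s (D.counit a) * b) x = _
    rw [map_mul, Module.End.mul_apply, D.toEnd_source, D.base_counit, evPair_tmul]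
  refine congr($this w).trans ?_
  rw [D.evPair_of_mk₂_eq_comul h, one_mul]

theorem counit_right (c : C) (w : C ⊗[K] C) (h : mk₂ s t w = D.comul c) :
    TensorProduct.lift (LinearMap.mul K C ∘ₗ t.toLinearMap ∘ₗ
      (opLinearEquiv K).toLinearMap ∘ₗ D.counit).flip w = c := by
  refine D.toEnd_ext fun x => ?_
  have : D.ev x ∘ₗ TensorProduct.lift (LinearMap.mul K C ∘ₗ t.toLinearMap ∘ₗ
      (opLinearEquiv K).toLinearMap ∘ₗ D.counit).flip = D.evPair x 1 :=
    TensorProduct.ext' fun a b => by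
      change D.toEnd (t (op (D.counit b)) * a) x = _
      rw [map_mul, Module.End.mul_apply, D.toEnd_target, D.base_counit, evPair_tmul]
  refine congr($this w).trans ?_
  rw [D.evPair_of_mk₂_eq_comul h, mul_one]

theorem takeuchi (c : C) (r : R) :
    act₂ s t (D.comul c) (t (op r) ⊗ₜ[K] 1) = act₂ s t (D.comul c) (1 ⊗ₜ[K] s r) := by
  refine D.tensor₂_ext fun x y => ?_
  rw [pairing₂_act₂, pairing₂_act₂, pairing₂_comul, pairing₂_comul, D.toEnd_source,
    D.toEnd_target, map_one, Module.End.one_apply, Module.End.one_apply, mul_assoc]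

theorem comul_mul (c d : C) (w : C ⊗[K] C) (h : mk₂ s t w = D.comul d) :
    D.comul (c * d) = act₂ s t (D.comul c) w := by
  refine D.tensor₂_ext fun x y => ?_
  have : D.pairing₂ x y ∘ₗ act₂ s t (D.comul c) = D.toEnd c ∘ₗ D.evPair x y :=
    TensorProduct.ext' fun a b => by
      rw [LinearMap.comp_apply, pairing₂_act₂, pairing₂_comul, LinearMap.comp_apply, evPair_tmul]
  rw [pairing₂_comul, map_mul D.toEnd, Module.End.mul_apply, ← D.evPair_of_mk₂_eq_comul h]
  exact congr($this w).symm

/-- The left bialgebroid structure with counit `c ↦ c(1)` on an algebra of endomorphisms. -/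
def leftBialgebroid : LeftBialgebroid K R C where
  source := s
  target := t
  source_target_comm r r' := D.toEnd_ext fun x => by
    simp [D.toEnd_source, D.toEnd_target, mul_assoc]
  counit := D.counit
  comul := D.comul
  counit_bimod r r' c := D.base_injective <| by
    simp [D.base_counit, D.toEnd_source, D.toEnd_target, mul_assoc]
  comul_bimod := D.comul_bimod
  coassoc := D.coassoc
  counit_left := D.counit_left
  counit_right := D.counit_right
  counit_one := D.base_injective <| by simp [D.base_counit]
  comul_one := D.comul_eq_mk₂ fun x y => by simp [evPair_tmul]
  takeuchi := D.takeuchi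
  comul_mul := D.comul_mul
  counit_mul_source c d := D.base_injective <| by
    simp [D.base_counit, D.toEnd_source]
  counit_mul_target c d := D.base_injective <| by
    simp [D.base_counit, D.toEnd_target]

/-- An algebra homomorphism from `R^e ⋈ G` that sends `r ⊗ s̄ ⋈ σ` to the endomorphism `λ_r σ ρ_s` is
a homomorphism of left bialgebroids: `Δ` is respected because `σ` is multiplicative. -/
theorem isHom_of_toEnd_pure {G : Type*} [Group G] [MulSemiringAction G R] [SMulCommClass G K R]
    (f : G →* (A ≃ₐ[K] A)) (hf : ∀ σ r, D.base (σ • r) = f σ (D.base r))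
    (Ψ : Bowtie K R G →ₐ[K] C)
    (hΨ : ∀ r r' σ x, D.toEnd (Ψ (Bowtie.pure K r r' σ)) x = D.base r * f σ (x * D.base r')) :
    (Bowtie.leftBialgebroid K).IsHom D.leftBialgebroid Ψ where
  map_source r := D.toEnd_ext fun x => by
    change D.toEnd (Ψ (Bowtie.pure K r 1 1)) x = D.toEnd (s r) x
    simp [hΨ, D.toEnd_source]
  map_target r := D.toEnd_ext fun x => by
    change D.toEnd (Ψ (Bowtie.pure K 1 r 1)) x = D.toEnd (t (op r)) x
    simp [hΨ, D.toEnd_target]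
  map_counit c := by
    have : D.counit ∘ₗ Ψ.toLinearMap = Bowtie.counit K :=
      Bowtie.hom_ext_pure fun r r' σ => D.base_injective <| by
        simp [D.base_counit, hΨ, Bowtie.counit_pure, hf]
    exact congr($this c)
  map_comul c w h := by
    refine D.comul_eq_mk₂ fun x y => ?_
    refine Bowtie.apply_eq_of_mk₂_eq_comul K
      (f := D.evPair x y ∘ₗ TensorProduct.map Ψ.toLinearMap Ψ.toLinearMap)
      (g := D.ev (x * y) ∘ₗ Ψ.toLinearMap) (fun r a b => ?_) (fun r r' σ => ?_) h
    · have h₁ : Ψ (Bowtie.target K (op r)) = t (op r) := D.toEnd_ext fun x => by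
        simp [Bowtie.target_op, hΨ, D.toEnd_target]
      have h₂ : Ψ (Bowtie.source K r) = s r := D.toEnd_ext fun x => by
        simp [Bowtie.source_apply, hΨ, D.toEnd_source]
      have := D.evPair_balanced x y r (Ψ a) (Ψ b)
      rw [← h₁, ← h₂, ← map_mul, ← map_mul] at this
      exact this
    · change D.toEnd (Ψ (Bowtie.pure K r 1 σ)) x * D.toEnd (Ψ (Bowtie.pure K 1 r' σ)) y =
        D.toEnd (Ψ (Bowtie.pure K r r' σ)) (x * y)
      simp [hΨ, mul_assoc]

end QuasibasisRep

/-! ### Bimodule endomorphisms of a left depth two extension -/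

section Extension

variable {K : Type v} [CommRing K] {A : Type u} [Ring A] [Algebra K A] {B : Subalgebra K A}

namespace biEnd

@[ext]
theorem ext {α β : biEnd B} (h : ∀ x, (α : Module.End K A) x = (β : Module.End K A) x) : α = β :=
  Subtype.ext (LinearMap.ext h)

/-- The endomorphism `λ_r ∘ σ ∘ ρ_s` in `𝒮`, for `r, s ∈ C_A(B)` and `σ ∈ Aut_B(A)`. -/
def twist (r s : centr B) (σ : BAut B) : biEnd B :=
  ⟨LinearMap.mulLeft K (r : A) ∘ₗ (σ : A ≃ₐ[K] A).toLinearMap ∘ₗ LinearMap.mulRight K (s : A), by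
    intro b hb a
    have hr := (Subalgebra.mem_centralizer_iff K).1 r.2 b hb
    have hs := (Subalgebra.mem_centralizer_iff K).1 s.2 b hb
    change r * (σ : A ≃ₐ[K] A) (b * a * s) = b * (r * (σ : A ≃ₐ[K] A) (a * s)) ∧
      r * (σ : A ≃ₐ[K] A) (a * b * s) = r * (σ : A ≃ₐ[K] A) (a * s) * b
    constructor
    · rw [mul_assoc b, map_mul, BAut.apply_mem B σ hb, ← mul_assoc, ← hr, mul_assoc]
    · rw [mul_assoc a, hs, ← mul_assoc, map_mul, BAut.apply_mem B σ hb, ← mul_assoc]⟩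

theorem twist_apply (r s : centr B) (σ : BAut B) (x : A) :
    (twist r s σ : Module.End K A) x = r * (σ : A ≃ₐ[K] A) (x * s) := rfl

/-- `twist` as a bilinear map in its first two arguments. -/
def twistBilin (σ : BAut B) : centr B →ₗ[K] centr B →ₗ[K] biEnd B :=
  LinearMap.mk₂ K (fun r s => twist r s σ)
    (fun _ _ _ => ext fun _ => by simp [twist_apply, add_mul])
    (fun _ _ _ => ext fun _ => by simp [twist_apply])
    (fun _ _ _ => ext fun _ => by simp [twist_apply, mul_add])
    (fun _ _ _ => ext fun _ => by simp [twist_apply])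

variable (B) in
/-- The source map `r ↦ λ_r`. -/
def source : centr B →ₐ[K] biEnd B :=
  AlgHom.ofLinearMap ((twistBilin 1).flip 1) (ext fun x => by simp [twistBilin, twist_apply])
    fun r r' => ext fun x => by simp [twistBilin, twist_apply, mul_assoc]

variable (B) in
/-- The target map `r̄ ↦ ρ_r`. -/
def target : (centr B)ᵐᵒᵖ →ₐ[K] biEnd B :=
  AlgHom.ofLinearMap (twistBilin 1 1 ∘ₗ (opLinearEquiv K).symm.toLinearMap)
    (ext fun x => by simp [twistBilin, twist_apply])
    fun r r' => ext fun x => by simp [twistBilin, twist_apply, mul_assoc]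

theorem source_apply (r : centr B) (x : A) : (source B r : Module.End K A) x = r * x := by
  simp [source, twistBilin, twist_apply]

theorem target_apply (r : centr B) (x : A) :
    (target B (op r) : Module.End K A) x = x * r := by
  simp [target, twistBilin, twist_apply]

variable (B) in
/-- The counit `α ↦ α(1)`. -/
def counit : biEnd B →ₗ[K] centr B where
  toFun α := ⟨(α : Module.End K A) 1, by
    rw [Subalgebra.mem_centralizer_iff]
    intro b hb
    rw [← (α.2 b hb 1).1, ← (α.2 b hb 1).2, mul_one, one_mul]⟩
  map_add' _ _ := rfl
  map_smul' _ _ := rfl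

theorem insertAt_tmul (α : biEnd B) (x u y : A) :
    insertAt B α x (TensorSquare.tmul B u y) = (α : Module.End K A) (x * u) * y :=
  TensorSquare.lift_tmul B _ _ u y

theorem insertAt_mkQ (α : biEnd B) (x : A) (v : A ⊗[K] A) :
    insertAt B α x (TensorSquare.mkQ B v) = LinearMap.mul' K A
      (TensorProduct.map ((α : Module.End K A) ∘ₗ LinearMap.mulLeft K x) LinearMap.id v) := by
  have : insertAt B α x ∘ₗ TensorSquare.mkQ B = LinearMap.mul' K A ∘ₗ
      TensorProduct.map ((α : Module.End K A) ∘ₗ LinearMap.mulLeft K x) LinearMap.id :=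
    TensorProduct.ext' fun p q => insertAt_tmul α x p q
  exact congr($this v)

theorem insertAt_op_smul (α : biEnd B) (x a : A) (t : TensorSquare B) :
    insertAt B α x (op a • t) = insertAt B α x t * a := by
  have : insertAt B α x ∘ₗ TensorSquare.rmul B (op a) =
      LinearMap.mulRight K a ∘ₗ insertAt B α x := TensorSquare.hom_ext fun u v => by
    have h : TensorSquare.rmul B (op a) (TensorSquare.tmul B u v) =
      TensorSquare.tmul B u (v * a) := TensorSquare.op_smul_tmul B a u v
    rw [LinearMap.comp_apply, LinearMap.comp_apply, h, insertAt_tmul, insertAt_tmul,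
      LinearMap.mulRight_apply, mul_assoc]
  exact congr($this t)

/-- `α ↦ α(? t¹) t²` as a linear map, for `t ∈ (A ⊗_B A)^B`. -/
def insertLin (t : TensorSquare B) (ht : ∀ b ∈ B, b • t = op b • t) : biEnd B →ₗ[K] biEnd B where
  toFun α := insert B α t ht
  map_add' α β := ext fun x => by
    have : insertAt B (α + β) x = insertAt B α x + insertAt B β x :=
      TensorSquare.hom_ext fun u v => by simp [insertAt_tmul, add_mul]
    exact congr($this t)
  map_smul' k α := ext fun x => by
    have : insertAt B (k • α) x = k • insertAt B α x :=
      TensorSquare.hom_ext fun u v => by simp [insertAt_tmul]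
    exact congr($this t)

end biEnd

namespace LeftQuasibases

open biEnd

variable (Q : LeftQuasibases B)

theorem sum_insertAt_mul (α : biEnd B) (x y : A) :
    ∑ i, insertAt B α x (Q.t i) * (Q.β i : Module.End K A) y = (α : Module.End K A) (x * y) := by
  have h := congr(insertAt B α x $(Q.sum_eq y 1))
  rw [map_sum, insertAt_tmul, mul_one] at h
  simpa only [insertAt_op_smul, mul_one] using h

/-- The realization of `End(_B A_B)` as an algebra of endomorphisms of `A` with quasibases. -/
def rep : QuasibasisRep (R := centr B) (C := biEnd B) (source B) (target B) A where
  toEnd := (biEnd B).val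
  toEnd_injective := Subtype.val_injective
  base := (centr B).val
  base_injective := Subtype.val_injective
  toEnd_source := source_apply
  toEnd_target := target_apply
  counit := counit B
  base_counit _ := rfl
  n := Q.n
  tens i := (Submodule.mkQ_surjective _ (Q.t i)).choose
  insert i := insertLin (Q.t i) (Q.t_central i)
  toEnd_insert i α x := by
    refine Eq.trans ?_ (insertAt_mkQ α x _)
    exact congr(insertAt B α x $((Submodule.mkQ_surjective _ (Q.t i)).choose_spec)).symm
  gen := Q.β
  sum_insert_mul := Q.sum_insertAt_mul

/-- Any two quasibases give the same `Δ`, as `Δ(α)` is determined by the map `x ⊗ y ↦ α(x y)`. -/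
theorem isEndBialgebroid : IsEndBialgebroid B Q.rep.leftBialgebroid where
  source_eq r := LinearMap.ext fun x => source_apply r x
  target_eq r := LinearMap.ext fun x => target_apply r x
  counit_eq _ := rfl
  exists_quasibases := ⟨Q⟩
  comul_eq Q' α := Q.rep.comul_eq_mk₂ fun x y => by
    rw [map_sum]
    exact Q'.sum_insertAt_mul α x y

end LeftQuasibases

end Extension

/-! ### Pseudo-Galois extensions -/

section PseudoGalois

variable {K : Type v} [CommRing K] {A : Type u} [Ring A] [Algebra K A] {B : Subalgebra K A}

/-- The generator `1` of the bimodule `A_σ`. -/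
def Twisted.one (σ : A ≃ₐ[K] A) : Twisted σ := (1 : A)

theorem Twisted.smul_one (σ : A ≃ₐ[K] A) (a : A) : (a • Twisted.one σ : Twisted σ) = a :=
  mul_one a

theorem Twisted.op_smul_one (σ : A ≃ₐ[K] A) (y : A) :
    op y • Twisted.one σ = σ y • Twisted.one σ :=
  (one_mul (σ y)).trans (mul_one (σ y)).symm

/-- A pseudo-Galois extension has left depth two quasibases whose `β_i` have the form `σ⁻¹ ∘ ρ_c`
with `σ ∈ 𝒢` and `c ∈ R`. The split monomorphism of bimodules `A ⊗_B A → ⨁ A_σ^N` sends `1 ⊗ 1` to a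
family of elements `c ∈ R`, and its retraction sends the basis vectors to elements `t` of
`(A ⊗_B A)^B` with `t y = σ(y) t`. -/
theorem IsPseudoGalois.exists_quasibases {𝒢 : Finset (BAut B)} (h : IsPseudoGalois B 𝒢) :
    ∃ Q : LeftQuasibases B, ∀ i, ∃ σ ∈ 𝒢, ∃ c : centr B, Q.β i = biEnd.twist 1 c σ⁻¹ := by
  classical
  obtain ⟨N, -, M, _, _, _, _, e, he⟩ := h
  have he_symm : ∀ (a : A) (z : (σ : 𝒢) → Fin N → Twisted (σ.1 : A ≃ₐ[K] A)),
      e.symm (op a • z) = op a • e.symm z := fun a z => by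
    rw [LinearEquiv.symm_apply_eq, he, LinearEquiv.apply_symm_apply]
  let one : TensorSquare B × M := (TensorSquare.tmul B 1 1, 0)
  let c₀ : 𝒢 × Fin N → A := fun p => e one p.1 p.2
  have hc : ∀ p, c₀ p ∈ centr B := fun p => by
    rw [Subalgebra.mem_centralizer_iff]
    intro b hb
    have h₁ : b • one = op b • one := by
      refine Prod.ext ?_ ((smul_zero b).trans (smul_zero (op b)).symm)
      change b • TensorSquare.tmul B 1 1 = op b • TensorSquare.tmul B 1 1
      rw [TensorSquare.smul_tmul, TensorSquare.op_smul_tmul, mul_one, one_mul]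
      simpa using TensorSquare.tmul_balanced B 1 ⟨b, hb⟩ 1
    have h₂ := congr(e $h₁ p.1 p.2)
    rw [map_smul, he] at h₂
    exact (h₂ : b * c₀ p = c₀ p * (p.1.1 : A ≃ₐ[K] A) b).trans
      congr(c₀ p * $(BAut.apply_mem B p.1.1 hb))
  let c : 𝒢 × Fin N → centr B := fun p => ⟨c₀ p, hc p⟩
  let v : 𝒢 × Fin N → ((σ : 𝒢) → Fin N → Twisted (σ.1 : A ≃ₐ[K] A)) := fun p =>
    Pi.single p.1 (Pi.single p.2 (Twisted.one _))
  let t : 𝒢 × Fin N → TensorSquare B := fun p => (e.symm (v p)).1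
  have ht : ∀ p (y : A), op y • t p = (p.1.1 : A ≃ₐ[K] A) y • t p := fun p y => by
    have h₁ : op y • v p = (p.1.1 : A ≃ₐ[K] A) y • v p := by
      rw [← Pi.single_smul, ← Pi.single_smul, ← Pi.single_smul, ← Pi.single_smul,
        Twisted.op_smul_one]
    have h₂ := congr((e.symm $h₁).1)
    rwa [he_symm, map_smul] at h₂
  have hsum : ∀ x y : A, ∑ p, (x * c₀ p * (p.1.1 : A ≃ₐ[K] A) y) • t p =
      TensorSquare.tmul B x y := fun x y => by
    have h₁ : op y • x • one = (TensorSquare.tmul B x y, 0) := by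
      refine Prod.ext ?_ ((congrArg _ (smul_zero x)).trans (smul_zero (op y)))
      change op y • x • TensorSquare.tmul B 1 1 = _
      rw [TensorSquare.smul_tmul, TensorSquare.op_smul_tmul, mul_one, one_mul]
    have h₂ : ∑ p, (x * c₀ p * (p.1.1 : A ≃ₐ[K] A) y) • v p = e (op y • x • one) := by
      rw [he, map_smul]
      funext σ i
      rw [Finset.sum_apply, Finset.sum_apply, Fintype.sum_eq_single (σ, i)]
      · have : v (σ, i) σ i = Twisted.one _ := by simp only [v, Pi.single_eq_same]
        rw [Pi.smul_apply, Pi.smul_apply, this, Twisted.smul_one]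
        rfl
      · rintro ⟨σ', i'⟩ hne
        have : v (σ', i') σ i = 0 := by
          by_cases hσ : σ = σ'
          · subst hσ
            have hi : i ≠ i' := fun hi => hne (by rw [hi])
            simp only [v, Pi.single_eq_same, Pi.single_eq_of_ne hi]
          · simp only [v, Pi.single_eq_of_ne hσ, Pi.zero_apply]
        rw [Pi.smul_apply, Pi.smul_apply, this, smul_zero]
    have h₃ := congr((e.symm $h₂).1)
    rw [LinearEquiv.symm_apply_apply, h₁, map_sum, Prod.fst_sum] at h₃
    refine Eq.trans ?_ h₃
    exact Finset.sum_congr rfl fun p _ => by rw [map_smul]; rfl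
  let φ := (Fintype.equivFin (𝒢 × Fin N)).symm
  refine ⟨⟨Fintype.card (𝒢 × Fin N), fun i => t (φ i), fun i b hb => ?_,
    fun i => biEnd.twist 1 (c (φ i)) (φ i).1.1⁻¹, fun x y => ?_⟩,
    fun i => ⟨(φ i).1.1, (φ i).1.2, c (φ i), rfl⟩⟩
  · rw [ht, BAut.apply_mem B _ hb]
  · rw [φ.sum_comp fun p => op ((biEnd.twist 1 (c p) p.1.1⁻¹ : Module.End K A) x * y) • t p,
      ← hsum x y]
    refine Finset.sum_congr rfl fun p _ => ?_
    rw [ht, biEnd.twist_apply, map_mul, map_mul]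
    simp [c]

namespace biEnd

/-- The algebra homomorphism `R^e ⋈ G → 𝒮`, `r ⊗ s̄ ⋈ σ ↦ λ_r ∘ σ ∘ ρ_s`, for a subgroup `G` of
`Aut_B(A)`. -/
def ofBowtie (G : Subgroup (BAut B)) : Bowtie K (centr B) G →ₐ[K] biEnd B :=
  Bowtie.liftAlgHom K (R := centr B) (C := biEnd B) (fun σ : G => twistBilin (σ : BAut B))
    (ext fun x => by simp [twistBilin, twist_apply]) fun r s p q σ τ => ext fun x => by
      have hs : (σ : A ≃ₐ[K] A) ((τ : A ≃ₐ[K] A) ((τ⁻¹ • s : centr B) : A)) =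
          (σ : A ≃ₐ[K] A) s := congrArg _ ((τ : A ≃ₐ[K] A).apply_symm_apply s)
      change r * (σ : A ≃ₐ[K] A) p *
          (σ : A ≃ₐ[K] A) ((τ : A ≃ₐ[K] A) (x * (q * (τ⁻¹ • s : centr B)))) =
        r * (σ : A ≃ₐ[K] A) (p * (τ : A ≃ₐ[K] A) (x * q) * s)
      simp only [map_mul, hs, mul_assoc]

theorem ofBowtie_pure (G : Subgroup (BAut B)) (r s : centr B) (σ : G) :
    ofBowtie G (Bowtie.pure K r s σ) = twist r s (σ : BAut B) :=
  Bowtie.liftAlgHom_pure K _ _ _ r s σ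

theorem ofBowtie_surjective (G : Subgroup (BAut B)) (Q : LeftQuasibases B)
    (hQ : ∀ i, ∃ σ ∈ G, ∃ c : centr B, Q.β i = twist 1 c σ) :
    Function.Surjective (ofBowtie G) := by
  refine Q.rep.surjective_of_mem_range (ofBowtie G) (fun r => ?_) fun i => ?_
  · exact ⟨Bowtie.pure K r 1 1, ofBowtie_pure G r 1 1⟩
  · obtain ⟨σ, hσ, c, hc⟩ := hQ i
    exact ⟨Bowtie.pure K 1 c ⟨σ, hσ⟩, (ofBowtie_pure G 1 c ⟨σ, hσ⟩).trans hc.symm⟩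

end biEnd

end PseudoGalois

end

theorem mainTheorem2 {K : Type v} [CommRing K] {A : Type u} [Ring A] [Algebra K A]
    (B : Subalgebra K A) (𝒢 : Finset (BAut B)) (h𝒢 : IsPseudoGalois B 𝒢) :
    -- the product and the unit of `R^e ⋈ G`, where `G` is generated by `𝒢` and `R = C_A(B)`
    (∀ (r s p q : centr B) (σ τ : Subgroup.closure (𝒢 : Set (BAut B))),
      Bowtie.pure K r s σ * Bowtie.pure K p q τ =
        Bowtie.pure K (r * σ • p) (q * τ⁻¹ • s) (σ * τ)) ∧
    (1 : Bowtie K (centr B) (Subgroup.closure (𝒢 : Set (BAut B)))) = Bowtie.pure K 1 1 1 ∧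
    ∃ H : HopfAlgebroid K (centr B)
        (Bowtie K (centr B) (Subgroup.closure (𝒢 : Set (BAut B)))),
      (∀ r, H.source r = Bowtie.pure K r 1 1) ∧
      (∀ r, H.target (op r) = Bowtie.pure K 1 r 1) ∧
      (∀ r s σ, H.counit (Bowtie.pure K r s σ) = r * σ • s) ∧
      (∀ r s σ, H.comul (Bowtie.pure K r s σ) =
        mk₂ H.source H.target (Bowtie.pure K r 1 σ ⊗ₜ[K] Bowtie.pure K 1 s σ)) ∧
      (∀ r s σ, H.antipode (Bowtie.pure K r s σ) = op (Bowtie.pure K s r σ⁻¹)) ∧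
      -- the epimorphism onto the left bialgebroid `𝒮`
      ∃ S : LeftBialgebroid K (centr B) (biEnd B), IsEndBialgebroid B S ∧
        ∃ Ψ : Bowtie K (centr B) (Subgroup.closure (𝒢 : Set (BAut B))) →ₐ[K] biEnd B,
          (∀ (r s : centr B) (σ : Subgroup.closure (𝒢 : Set (BAut B))),
            (Ψ (Bowtie.pure K r s σ) : Module.End K A) =
              LinearMap.mulLeft K (r : A) ∘ₗ ((σ : BAut B) : A ≃ₐ[K] A).toLinearMap ∘ₗ
                LinearMap.mulRight K (s : A)) ∧
          H.toLeftBialgebroid.IsHom S Ψ ∧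
          Function.Surjective Ψ := by
  obtain ⟨Q, hQ⟩ := h𝒢.exists_quasibases
  refine ⟨Bowtie.pure_mul_pure K, rfl, Bowtie.hopfAlgebroid K, fun _ => rfl, fun _ => rfl,
    Bowtie.counit_pure K, Bowtie.comul_pure K,
    fun r s σ => congrArg op (Bowtie.antipodeLin_pure K r s σ),
    Q.rep.leftBialgebroid, Q.isEndBialgebroid, biEnd.ofBowtie _, fun r s σ => ?_, ?_, ?_⟩
  · rw [biEnd.ofBowtie_pure]
    rfl
  · refine Q.rep.isHom_of_toEnd_pure ((Subgroup.subtype _).comp (Subgroup.subtype _))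
      (fun _ _ => rfl) _ fun r s σ x => ?_
    rw [biEnd.ofBowtie_pure]
    rfl
  · refine biEnd.ofBowtie_surjective _ Q fun i => ?_
    obtain ⟨σ, hσ, c, hc⟩ := hQ i
    exact ⟨σ⁻¹, inv_mem (Subgroup.subset_closure hσ), c, hc⟩
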